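/- Let $c\in\mathbb C\setminus\{0\}$, $g(x,y)=\frac{c}{x-y}$, $f(x,y)=\frac{x-y+c}{x-y}$, $h(x,y)=\frac{x-y+c}{c}$, and let $[1]=[2]=0$, $[3]=1$. Let $\mathcal H$ be a complex vector space, $D\subseteq\mathbb C$ a set of spectral parameters, and let $T_{ij}(u)$ ($1\le i,j\le 3$, $u\in D$) be linear operators on $\mathcal H$ satisfying the $\mathfrak{gl}(2|1)$ relations $$T_{ij}(u)T_{kl}(v)-(-1)^{([i]+[j])([k]+[l])}T_{kl}(v)T_{ij}(u)=(-1)^{[i]([k]+[l])+[k][l]}g(u,v)\bigl(T_{kj}(v)T_{il}(u)-T_{kj}(u)T_{il}(v)\bigr)$$ for all distinct $u,v\in D$. For an ordered set $\bar x=\{x_1,\dots,x_n\}$ put $T_{ij}(\bar x)=T_{ij}(x_1)\cdots T_{ij}(x_n)$ if $[i]+[j]$ is even, and for $j=1,2$ $$\mathbb T_{j3}(\bar x)=\frac{T_{j3}(x_1)\cdots T_{j3}(x_n)}{\prod_{l>m}h(x_l,x_m)},\qquad \mathbb T_{3j}(\bar x)=\frac{T_{3j}(x_1)\cdots T_{3j}(x_n)}{\prod_{l>m}h(x_m,x_l)}.$$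 A scalar function of one or two variables written with sets as arguments denotes the product over all their elements (all pairs). For $\#\bar x=\#\bar y=n$ let $$K(\bar x|\bar y)=\prod_{j<k}g(x_j,x_k)\prod_{j>k}g(y_j,y_k)\;h(\bar x,\bar y)\det_n\Bigl(\frac{g(x_j,y_k)}{h(x_j,y_k)}\Bigr),\qquad K(\emptyset|\emptyset)=1.$$ For $\bar u=\{u_1,\dots,u_a\}$ and $\bar v=\{v_1,\dots,v_b\}$ ($a,b\ge0$) in $D$ define $$X_{a,b}(\bar u,\bar v)=\sum g(\bar v_\alpha,\bar u_\alpha)f(\bar u_\alpha,\bar u_{\bar\alpha})g(\bar v_{\bar\alpha},\bar v_\alpha)h(\bar u_\alpha,\bar u_\alpha)\,\mathbb T_{13}(\bar u_\alpha)T_{12}(\bar u_{\bar\alpha})\mathbb T_{23}(\bar v_{\bar\alpha})T_{22}(\bar v_\alpha),$$ $$Y_{a,b}(\bar u,\bar v)=\sum K(\bar v_\alpha|\bar u_\alpha)f(\bar u_\alpha,\bar u_{\bar\alpha})g(\bar v_{\bar\alpha},\bar v_\alpha)\,\mathbb T_{13}(\bar v_\alpha)\mathbb T_{23}(\bar v_{\bar\alpha})T_{12}(\bar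 u_{\bar\alpha})T_{22}(\bar u_\alpha),$$ the sums being over all partitions $\bar u\Rightarrow\{\bar u_\alpha,\bar u_{\bar\alpha}\}$, $\bar v\Rightarrow\{\bar v_\alpha,\bar v_{\bar\alpha}\}$ with $\#\bar u_\alpha=\#\bar v_\alpha=n$, $n=0,1,\dots,\min(a,b)$, every subset in its natural order; let $X^{(n)}$, $Y^{(n)}$ be the partial sums with $n$ fixed. Assume that no denominator vanishes: the numbers $u_1,\dots,u_a,v_1,\dots,v_b$ are pairwise distinct, and $u_i-u_j+c\ne0$, $v_i-v_j+c\neq0$, $v_j-u_i+c\ne0$ for all $i,j$. Then, for all $a$ and $b$: 1. $X_{a,b}(\bar u,\bar v)=Y_{a,b}(\bar u,\bar v)$; equivalently, $[T_{12}(\bar u),\mathbb T_{23}(\bar v)]=\sum_{n=1}^{\min(a,b)}\bigl(Y^{(n)}-X^{(n)}\bigr)$. 2. Let $\Omega\in\mathcal H$ satisfy $T_{ii}(u)\Omega=\lambda_i(u)\Omega$ and $T_{ij}(u)\Omega=0$ for $i>j$ ($u\in D$). Then the Bethe vector $\Phi_{a,b}(\bar u,\bar v)=X_{a,b}(\bar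 u,\bar v)\Omega$ satisfies $\Phi_{a,b}=Y_{a,b}\Omega$, and $$\Phi_{a,b}=\sum g(\bar v_\alpha,\bar u_\alpha)f(\bar u_\alpha,\bar u_{\bar\alpha})g(\bar v_{\bar\alpha},\bar v_\alpha)h(\bar u_\alpha,\bar u_\alpha)\,\lambda_2(\bar v_\alpha)\,\mathbb T_{13}(\bar u_\alpha)T_{12}(\bar u_{\bar\alpha})\mathbb T_{23}(\bar v_{\bar\alpha})\Omega$$ $$\phantom{\Phi_{a,b}}=\sum K(\bar v_\alpha|\bar u_\alpha)f(\bar u_\alpha,\bar u_{\bar\alpha})g(\bar v_{\bar\alpha},\bar v_\alpha)\,\lambda_2(\bar u_\alpha)\,\mathbb T_{13}(\bar v_\alpha)\mathbb T_{23}(\bar v_{\bar\alpha})T_{12}(\bar u_{\bar\alpha})\Omega .$$ 3. Let $\psi$ be the linear map on noncommutative polynomials in the symbols $T_{ij}(u)$ with $\psi(1)=1$, $\psi(T_{ij}(u))=(-1)^{[i][j]+[i]}T_{ji}(u)$ and $\psi(AB)=(-1)^{[A][B]}\psi(B)\psi(A)$ for monomials $A,B$, the parity of a monomial being the sum of the parities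 $[i]+[j]$ of its letters. Let $\Omega^\dagger\in\mathcal H^*$ satisfy $\Omega^\dagger T_{ii}(u)=\lambda_i(u)\Omega^\dagger$ and $\Omega^\dagger T_{ij}(u)=0$ for $i<j$ ($u\in D$). Then the dual Bethe vector $\Phi^\dagger_{a,b}(\bar u,\bar v)=\Omega^\dagger\,\psi(X_{a,b}(\bar u,\bar v))$ satisfies $$\Phi^\dagger_{a,b}=(-1)^{b(b-1)/2}\sum g(\bar v_\alpha,\bar u_\alpha)f(\bar u_\alpha,\bar u_{\bar\alpha})g(\bar v_{\bar\alpha},\bar v_\alpha)h(\bar u_\alpha,\bar u_\alpha)\,\lambda_2(\bar v_\alpha)\,\Omega^\dagger\,\mathbb T_{32}(\bar v_{\bar\alpha})T_{21}(\bar u_{\bar\alpha})\mathbb T_{31}(\bar u_\alpha)$$ $$\phantom{\Phi^\dagger_{a,b}}=(-1)^{b(b-1)/2}\sum K(\bar v_\alpha|\bar u_\alpha)f(\bar u_\alpha,\bar u_{\bar\alpha})g(\bar v_{\bar\alpha},\bar v_\alpha)\,\lambda_2(\bar u_\alpha)\,\Omega^\dagger\,T_{21}(\bar u_{\bar\alpha})\mathbb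 T_{32}(\bar v_{\bar\alpha})\mathbb T_{31}(\bar v_\alpha).$$ All sums in 2 and 3 are over the same partitions as in the definition of $X_{a,b}$ and $Y_{a,b}$. -/

import Mathlib

open Finset

namespace SuperYangian

noncomputable section

/-! The indices `1, 2, 3` of the monodromy matrix are `0, 1, 2 : Fin 3`. -/

/-- The parity `[1] = [2] = 0`, `[3] = 1`. -/
def par : Fin 3 → ℕ := ![0, 0, 1]

/-- `g(x,y) = c / (x - y)`. -/
def g (c x y : ℂ) : ℂ := c / (x - y)

/-- `f(x,y) = (x - y + c) / (x - y)`. -/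
def f (c x y : ℂ) : ℂ := (x - y + c) / (x - y)

/-- `h(x,y) = (x - y + c) / c`. -/
def h (c x y : ℂ) : ℂ := (x - y + c) / c

/-- The commutation relations of the entries `T i j u` of a `gl(2|1)` monodromy matrix, for all
pairs of distinct spectral parameters in `D`: the graded commutator of `T i j u` and `T k l v` is
`(-1)^([i]([k]+[l])+[k][l]) g(u,v) (T k j v * T i l u - T k j u * T i l v)`. -/
def IsMonodromy {A : Type*} [Ring A] [Algebra ℂ A] (c : ℂ) (D : Set ℂ)
    (T : Fin 3 → Fin 3 → ℂ → A) : Prop :=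
  ∀ i j k l : Fin 3, ∀ u ∈ D, ∀ v ∈ D, u ≠ v →
    T i j u * T k l v
        - ((-1 : ℂ) ^ ((par i + par j) * (par k + par l))) • (T k l v * T i j u)
      = ((-1 : ℂ) ^ (par i * (par k + par l) + par k * par l) * g c u v) •
          (T k j v * T i l u - T k j u * T i l v)

section Products

variable {ι κ : Type*} [LinearOrder ι]

/-- `φ(x̄_s, ȳ_t)`: the product of `φ (x i) (y j)` over `i ∈ s`, `j ∈ t`. -/
def prod₂ {ι κ : Type*} (φ : ℂ → ℂ → ℂ) (x : ι → ℂ) (s : Finset ι) (y : κ → ℂ) (t : Finset κ) :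
    ℂ :=
  ∏ i ∈ s, ∏ j ∈ t, φ (x i) (y j)

/-- The product `F (x i₁) * ⋯ * F (x iₙ)` over `s = {i₁ < ⋯ < iₙ}`, in increasing order. -/
def ordProd {A : Type*} [Ring A] (F : ℂ → A) (x : ι → ℂ) (s : Finset ι) : A :=
  (s.sort.map fun i => F (x i)).prod

/-- `𝕋_{j3}(x̄_s)`: the ordered product of the `T_{j3}(x_i)`, divided by the product of
`h(x_l, x_m)` over `l > m`. -/
def colT {A : Type*} [Ring A] [Algebra ℂ A] (c : ℂ) (T : Fin 3 → Fin 3 → ℂ → A) (j : Fin 3)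
    (x : ι → ℂ) (s : Finset ι) : A :=
  (∏ l ∈ s, ∏ m ∈ s with m < l, h c (x l) (x m))⁻¹ • ordProd (T j 2) x s

/-- `𝕋_{3k}(x̄_s)`: the ordered product of the `T_{3k}(x_i)`, divided by the product of
`h(x_m, x_l)` over `l > m`. -/
def rowT {A : Type*} [Ring A] [Algebra ℂ A] (c : ℂ) (T : Fin 3 → Fin 3 → ℂ → A) (k : Fin 3)
    (x : ι → ℂ) (s : Finset ι) : A :=
  (∏ l ∈ s, ∏ m ∈ s with m < l, h c (x m) (x l))⁻¹ • ordProd (T 2 k) x s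

end Products

/-- The domain wall partition function `K(x̄|ȳ)` in its determinant representation. -/
def dwpf (c : ℂ) {n : ℕ} (x y : Fin n → ℂ) : ℂ :=
  (∏ j, ∏ k with j < k, g c (x j) (x k)) * (∏ j, ∏ k with k < j, g c (y j) (y k)) *
    (∏ j, ∏ k, h c (x j) (y k)) *
    Matrix.det (Matrix.of fun j k => g c (x j) (y k) / h c (x j) (y k))

/-- The `n`-element subsets `α` of the index set `{1, …, a}`; such a subset encodes the partition
of `ū = {u₁, …, u_a}` into `ū_α` and its complement. -/
abbrev Sub (a n : ℕ) : Type := {s : Finset (Fin a) // s.card = n}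

/-- The subset `ū_α`, in its natural order, as an `n`-tuple. -/
def Sub.tuple {a n : ℕ} (α : Sub a n) (u : Fin a → ℂ) : Fin n → ℂ :=
  fun i => u (α.1.orderEmbOfFin α.2 i)

/-- The coefficient `g(v̄_β, ū_α) f(ū_α, ū_ᾱ) g(v̄_β̄, v̄_β) h(ū_α, ū_α)`. -/
def coeffX (c : ℂ) {a b n : ℕ} (u : Fin a → ℂ) (v : Fin b → ℂ) (α : Sub a n) (β : Sub b n) : ℂ :=
  prod₂ (g c) v β.1 u α.1 * prod₂ (f c) u α.1 u α.1ᶜ * prod₂ (g c) v β.1ᶜ v β.1 *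
    prod₂ (h c) u α.1 u α.1

/-- The coefficient `K(v̄_β | ū_α) f(ū_α, ū_ᾱ) g(v̄_β̄, v̄_β)`. -/
def coeffY (c : ℂ) {a b n : ℕ} (u : Fin a → ℂ) (v : Fin b → ℂ) (α : Sub a n) (β : Sub b n) : ℂ :=
  dwpf c (β.tuple v) (α.tuple u) * prod₂ (f c) u α.1 u α.1ᶜ * prod₂ (g c) v β.1ᶜ v β.1

section Operators

variable {A : Type*} [Ring A] [Algebra ℂ A]

/-- The terms of `X_{a,b}(ū, v̄)` with `#ū_α = #v̄_β = n`. -/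
def partX (c : ℂ) (T : Fin 3 → Fin 3 → ℂ → A) {a b : ℕ} (u : Fin a → ℂ) (v : Fin b → ℂ)
    (n : ℕ) : A :=
  ∑ α : Sub a n, ∑ β : Sub b n, coeffX c u v α β •
    (colT c T 0 u α.1 * ordProd (T 0 1) u α.1ᶜ * colT c T 1 v β.1ᶜ * ordProd (T 1 1) v β.1)

/-- The terms of `Y_{a,b}(ū, v̄)` with `#ū_α = #v̄_β = n`. -/
def partY (c : ℂ) (T : Fin 3 → Fin 3 → ℂ → A) {a b : ℕ} (u : Fin a → ℂ) (v : Fin b → ℂ)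
    (n : ℕ) : A :=
  ∑ α : Sub a n, ∑ β : Sub b n, coeffY c u v α β •
    (colT c T 0 v β.1 * colT c T 1 v β.1ᶜ * ordProd (T 0 1) u α.1ᶜ * ordProd (T 1 1) u α.1)

/-- The operator `X_{a,b}(ū, v̄)`. -/
def opX (c : ℂ) (T : Fin 3 → Fin 3 → ℂ → A) {a b : ℕ} (u : Fin a → ℂ) (v : Fin b → ℂ) : A :=
  ∑ n ∈ range (min a b + 1), partX c T u v n

/-- The operator `Y_{a,b}(ū, v̄)`. -/
def opY (c : ℂ) (T : Fin 3 → Fin 3 → ℂ → A) {a b : ℕ} (u : Fin a → ℂ) (v : Fin b → ℂ) : A :=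
  ∑ n ∈ range (min a b + 1), partY c T u v n

end Operators

/-! The antimorphism `ψ`, on polynomials in the noncommuting symbols `T_{ij}(u)`. -/

/-- The symbols `T_{ij}(u)`. -/
abbrev Gen : Type := Fin 3 × Fin 3 × ℂ

/-- `T_{ij}(u)` as a generator of the free algebra. -/
def genT (i j : Fin 3) (u : ℂ) : FreeAlgebra ℂ Gen := FreeAlgebra.ι ℂ (i, j, u)

/-- The parity of the monomial with the given letters. -/
def wordPar (w : List Gen) : ℕ := (w.map fun x => par x.1 + par x.2.1).sum

/-- `ψ` on monomials: `ψ(T_{ij}(u)) = (-1)^([i][j]+[i]) T_{ji}(u)` and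
`ψ(x w) = (-1)^([x][w]) ψ(w) ψ(x)`. -/
def psiWord : List Gen → FreeAlgebra ℂ Gen
  | [] => 1
  | x :: w => ((-1 : ℂ) ^ ((par x.1 + par x.2.1) * wordPar w)) •
      (psiWord w * (((-1 : ℂ) ^ (par x.1 * par x.2.1 + par x.1)) • genT x.2.1 x.1 x.2.2))

/-- The linear map `ψ`. -/
def psi : FreeAlgebra ℂ Gen →ₗ[ℂ] FreeAlgebra ℂ Gen :=
  (FreeAlgebra.basisFreeMonoid ℂ Gen).constr ℂ fun w => psiWord w.toList

section Vectors

variable {H : Type*} [AddCommGroup H] [Module ℂ H]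

/-- The value of a noncommutative polynomial in the symbols `T_{ij}(u)` on given operators. -/
def evalT (T : Fin 3 → Fin 3 → ℂ → Module.End ℂ H) : FreeAlgebra ℂ Gen →ₐ[ℂ] Module.End ℂ H :=
  FreeAlgebra.lift ℂ fun x => T x.1 x.2.1 x.2.2

/-- `Ω` is a pseudovacuum with eigenvalues `lam i u`. -/
def IsVacuum (D : Set ℂ) (T : Fin 3 → Fin 3 → ℂ → Module.End ℂ H) (lam : Fin 3 → ℂ → ℂ) (Ω : H) :
    Prop :=
  (∀ i, ∀ u ∈ D, T i i u Ω = lam i u • Ω) ∧ ∀ i j, j < i → ∀ u ∈ D, T i j u Ω = 0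

/-- `Ω'` is a dual pseudovacuum with eigenvalues `lam i u`; operators act on the dual space from
the right, by composition. -/
def IsDualVacuum (D : Set ℂ) (T : Fin 3 → Fin 3 → ℂ → Module.End ℂ H) (lam : Fin 3 → ℂ → ℂ)
    (Ω' : Module.Dual ℂ H) : Prop :=
  (∀ i, ∀ u ∈ D, Ω' ∘ₗ T i i u = lam i u • Ω') ∧ ∀ i j, i < j → ∀ u ∈ D, Ω' ∘ₗ T i j u = 0

/-- The Bethe vector `Φ_{a,b}(ū, v̄) = X_{a,b}(ū, v̄) Ω`. -/
def bethe (c : ℂ) (T : Fin 3 → Fin 3 → ℂ → Module.End ℂ H) (Ω : H) {a b : ℕ}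
    (u : Fin a → ℂ) (v : Fin b → ℂ) : H :=
  opX c T u v Ω

/-- The dual Bethe vector, the image `Ω' ψ(X_{a,b}(ū, v̄))` of the Bethe vector under `ψ`. -/
def dualBethe (c : ℂ) (T : Fin 3 → Fin 3 → ℂ → Module.End ℂ H) (Ω' : Module.Dual ℂ H) {a b : ℕ}
    (u : Fin a → ℂ) (v : Fin b → ℂ) : Module.Dual ℂ H :=
  Ω' ∘ₗ evalT T (psi (opX c genT u v))

end Vectors

end

end SuperYangian

/-! A new parameter enters `ū` in `X` by an operation with leading term left multiplication by
`T₁₂`, and in `Y` by one with leading term right multiplication by `T₁₂`. To see this, carry `T₁₂`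
through the products and collect the unwanted terms; their coefficients match by the residue
theorem for rational functions, in the form of Lagrange interpolation, and by the cofactor
expansion of `K`. The commutator of a left and a right operation only involves differences of the
two operations for a parameter taken from `v̄` instead, and those vanish by induction on `#ū`.
Hence `X`, built up from the left, and `Y`, built up from the right, agree.

For the dual vectors, `ψ` followed by a rescaling of the odd entries by `-i` is an ordinary
antihomomorphism, and the images of the `T_{ij}` satisfy the same relations in the opposite algebra.
So `X = Y` holds there as well, and only the powers of `i` have to be collected. -/

namespace SuperYangian

noncomputable section

section WeightedProducts

variable {ι A : Type*} [Ring A] [Algebra ℂ A]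

/-- The `t i` with `i ∈ s` commute up to the weights `w`, so that the product of the `t i`
times the `w i j` over its inversions does not depend on the order of the factors. -/
def WeightCommute (w : ι → ι → ℂ) (t : ι → A) (s : Finset ι) : Prop :=
  (s : Set ι).Pairwise fun j k => w j k • (t j * t k) = w k j • (t k * t j)

theorem WeightCommute.mono {w : ι → ι → ℂ} {t : ι → A} {s s' : Finset ι}
    (hw : WeightCommute w t s) (hs : s' ⊆ s) : WeightCommute w t s' :=
  Set.Pairwise.mono (coe_subset.mpr hs) hw

theorem weightCommute_one {t : ι → A} (ht : ∀ i j, t i * t j = t j * t i) (s : Finset ι) :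
    WeightCommute 1 t s :=
  fun j _ k _ _ => by simp only [Pi.one_apply, one_smul, ht j k]

variable [LinearOrder ι]

/-- The increasing product of the `t i`, `i ∈ s`, times the product of the weights `w m l` over
`m < l`. It covers the plain products `T_{ij}(x̄)` (with `w = 1`) as well as `𝕋_{j3}(x̄)` and
`𝕋_{3j}(x̄)`. -/
def wprod (w : ι → ι → ℂ) (t : ι → A) (s : Finset ι) : A :=
  (∏ l ∈ s, ∏ m ∈ s with m < l, w m l) • (s.sort.map t).prod

@[simp]
theorem wprod_empty (w : ι → ι → ℂ) (t : ι → A) : wprod w t ∅ = 1 := by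
  simp [wprod]

theorem wprod_insert_of_forall_lt (w : ι → ι → ℂ) (t : ι → A) {s : Finset ι} {m : ι}
    (hm : ∀ j ∈ s, m < j) :
    wprod w t (insert m s) = (∏ j ∈ s, w m j) • (t m * wprod w t s) := by
  have hms : m ∉ s := fun h => lt_irrefl _ (hm m h)
  have hfilter : ∀ l ∈ s, ∏ k ∈ insert m s with k < l, w k l
      = w m l * ∏ k ∈ s with k < l, w k l := fun l hl => by
    rw [filter_insert, if_pos (hm l hl), prod_insert (by simp [hms])]
  have hempty : (insert m s).filter (· < m) = ∅ :=
    filter_eq_empty_iff.mpr fun k hk => by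
      rcases mem_insert.mp hk with rfl | hk
      · exact lt_irrefl _
      · exact (hm k hk).not_gt
  rw [wprod, wprod, sort_insert _ (fun j hj => (hm j hj).le) hms, prod_insert hms, hempty,
    prod_empty, one_mul, prod_congr rfl hfilter, prod_mul_distrib, List.map_cons, List.prod_cons,
    mul_smul_comm, smul_smul]

theorem wprod_insert_left {w : ι → ι → ℂ} {t : ι → A} {s : Finset ι} {i : ι} (his : i ∉ s)
    (hw : WeightCommute w t (insert i s)) :
    wprod w t (insert i s) = (∏ j ∈ s, w i j) • (t i * wprod w t s) := by
  induction s using Finset.induction_on_min with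
  | empty => exact wprod_insert_of_forall_lt w t (by simp)
  | insert m s hm ih =>
    have hms : m ∉ s := fun h => lt_irrefl _ (hm m h)
    have him : i ≠ m := ne_of_mem_of_not_mem (mem_insert_self m s) his |>.symm
    have his' : i ∉ s := fun h => his (mem_insert_of_mem h)
    rcases lt_or_gt_of_ne him with hlt | hlt
    · exact wprod_insert_of_forall_lt w t
        (forall_mem_insert _ _ _ |>.mpr ⟨hlt, fun j hj => hlt.trans (hm j hj)⟩)
    · have hswap : w m i • (t m * t i) = w i m • (t i * t m) :=
        hw (by simp) (by simp) him.symm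
      rw [insert_comm, wprod_insert_of_forall_lt w t
          (forall_mem_insert _ _ _ |>.mpr ⟨hlt, hm⟩),
        ih his' (hw.mono (insert_subset_insert _ (subset_insert _ _))), prod_insert his',
        prod_insert hms, wprod_insert_of_forall_lt w t hm]
      calc (w m i * ∏ j ∈ s, w m j) • (t m * (∏ j ∈ s, w i j) • (t i * wprod w t s))
          = ((∏ j ∈ s, w m j) * ∏ j ∈ s, w i j) • ((w m i • (t m * t i)) * wprod w t s) := by
            simp only [mul_smul_comm, smul_mul_assoc, smul_smul, mul_assoc]
            congr 1; ring
        _ = _ := by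
            rw [hswap]
            simp only [mul_smul_comm, smul_mul_assoc, smul_smul, mul_assoc]
            congr 1; ring

theorem wprod_insert_right {w : ι → ι → ℂ} {t : ι → A} {s : Finset ι} {i : ι} (his : i ∉ s)
    (hw : WeightCommute w t (insert i s)) :
    wprod w t (insert i s) = (∏ j ∈ s, w j i) • (wprod w t s * t i) := by
  induction s using Finset.induction_on with
  | empty => simpa using wprod_insert_of_forall_lt w t (s := ∅) (m := i)
  | insert m s hms ih =>
    have hmi : m ∉ insert i s :=
      mt mem_insert.mp (not_or_intro (ne_of_mem_of_not_mem (mem_insert_self m s) his) hms)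
    have his' : i ∉ s := fun h => his (mem_insert_of_mem h)
    rw [insert_comm, wprod_insert_left hmi (by rwa [insert_comm]),
      ih his' (hw.mono (insert_subset_insert _ (subset_insert _ _))), prod_insert his',
      prod_insert hms, wprod_insert_left hms (hw.mono (subset_insert _ _))]
    simp only [mul_smul_comm, smul_mul_assoc, smul_smul, mul_assoc]
    congr 1; ring

theorem wprod_smul (w : ι → ι → ℂ) (k : ℂ) (t : ι → A) (s : Finset ι) :
    wprod w (fun i => k • t i) s = k ^ #s • wprod w t s := by
  induction s using Finset.induction_on_min with
  | empty => simp
  | insert m s hm ih =>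
    rw [wprod_insert_of_forall_lt _ _ hm, wprod_insert_of_forall_lt _ _ hm, ih,
      card_insert_of_notMem fun h => lt_irrefl _ (hm m h), smul_mul_smul_comm, smul_comm, pow_succ']

theorem unop_wprod {w : ι → ι → ℂ} {t : ι → Aᵐᵒᵖ} {s : Finset ι} (hw : WeightCommute w t s) :
    (wprod w t s).unop = wprod (fun i j => w j i) (fun i => (t i).unop) s := by
  induction s using Finset.induction_on_min with
  | empty => simp
  | insert m s hm ih =>
    rw [wprod_insert_right (fun h => lt_irrefl _ (hm m h)) hw, wprod_insert_of_forall_lt _ _ hm,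
      MulOpposite.unop_smul, MulOpposite.unop_mul, ih (hw.mono (subset_insert _ _))]

theorem wprod_map {κ : Type*} [LinearOrder κ] (e : κ ↪o ι) (w : ι → ι → ℂ) (t : ι → A)
    (s : Finset κ) :
    wprod w t (s.map e.toEmbedding) = wprod (fun i j => w (e i) (e j)) (t ∘ e) s := by
  induction s using Finset.induction_on_min with
  | empty => simp
  | insert m s hm ih =>
    have hm' : ∀ j ∈ s.map e.toEmbedding, e m < j := by
      simpa using hm
    rw [map_insert, wprod_insert_of_forall_lt _ _ hm]
    exact (wprod_insert_of_forall_lt _ _ hm').trans (by rw [ih, prod_map]; rfl)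

end WeightedProducts

section Scalars

variable {c : ℂ}

theorem f_eq_one_add_g {x y : ℂ} (hxy : x ≠ y) : f c x y = 1 + g c x y := by
  rw [f, g, add_div, div_self (sub_ne_zero.mpr hxy)]

theorem f_eq_g_mul_h (hc : c ≠ 0) (x y : ℂ) : f c x y = g c x y * h c x y := by
  rw [f, g, h, div_mul_div_cancel₀' hc]

theorem g_swap (x y : ℂ) : g c y x = -g c x y := by
  rw [g, g, ← neg_sub, div_neg]

theorem g_mul_g {x y z : ℂ} (hxy : x ≠ y) (hyz : y ≠ z) (hxz : x ≠ z) :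
    g c y z * g c x y = g c x z * (g c y z + g c x y) := by
  have hxy' := sub_ne_zero.mpr hxy
  have hyz' := sub_ne_zero.mpr hyz
  have hxz' := sub_ne_zero.mpr hxz
  simp only [g]
  field_simp
  ring

theorem g_mul_h_swap (hc : c ≠ 0) {x y : ℂ} (hxy : x ≠ y) : g c x y * h c y x = g c x y - 1 := by
  have hxy' := sub_ne_zero.mpr hxy
  rw [g, h]
  field_simp
  ring

theorem h_self (hc : c ≠ 0) (x : ℂ) : h c x x = 1 := by
  rw [h, sub_self, zero_add, div_self hc]

theorem g_ne_zero (hc : c ≠ 0) {x y : ℂ} (hxy : x ≠ y) : g c x y ≠ 0 :=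
  div_ne_zero hc (sub_ne_zero.mpr hxy)

theorem h_ne_zero (hc : c ≠ 0) {x y : ℂ} (hxy : x - y + c ≠ 0) : h c x y ≠ 0 :=
  div_ne_zero hxy hc

theorem g_neg (x y : ℂ) : g (-c) x y = g c y x := by
  rw [g, g, ← neg_sub x y, div_neg, neg_div]

theorem f_neg (x y : ℂ) : f (-c) x y = f c y x := by
  rw [f, f, ← neg_div_neg_eq]
  ring_nf

theorem h_neg (x y : ℂ) : h (-c) x y = h c y x := by
  rw [h, h, ← neg_div_neg_eq]
  ring_nf

end Scalars

section Exchange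

variable {ι A : Type*} [Ring A] [Algebra ℂ A] {c : ℂ} {x : ι → ℂ}

/-- An exchange relation of the rational `R`-matrix: carrying `b i` to the right of `t j`
produces, besides the wanted term, one in which the spectral parameters are swapped. -/
def Exchanges (c : ℂ) (x : ι → ℂ) (b t : ι → A) : Prop :=
  ∀ i j, i ≠ j → b i * t j = f c (x j) (x i) • (t j * b i) - g c (x j) (x i) • (t i * b j)

/-- The self-exchange relation of the `t i`, together with weights `w` that turn their products
into symmetric functions. The sign `ε` is `1` for commuting and `-1` for odd families. -/
structure SelfExchanges (c : ℂ) (x : ι → ℂ) (ε : ℂ) (w : ι → ι → ℂ) (t : ι → A) (s : Finset ι) :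
    Prop where
  weightCommute : WeightCommute w t s
  f_smul_mul : ∀ i j, i ≠ j →
    f c (x i) (x j) • (t i * t j) = (g c (x i) (x j) + ε) • (t j * t i)
  weight_mul_f : ∀ i ∈ s, ∀ j ∈ s, i ≠ j →
    w i j * f c (x j) (x i) = w j i * (g c (x j) (x i) + ε)

theorem SelfExchanges.mono {ε : ℂ} {w : ι → ι → ℂ} {t : ι → A} {s s' : Finset ι}
    (ht : SelfExchanges c x ε w t s) (hs : s' ⊆ s) : SelfExchanges c x ε w t s' where
  weightCommute := ht.weightCommute.mono hs
  f_smul_mul := ht.f_smul_mul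
  weight_mul_f i hi j hj := ht.weight_mul_f i (hs hi) j (hs hj)

variable [LinearOrder ι]

/-- The unwanted term that exchanges the parameters `x o` and `x i` when `b o` is carried through
the product of the `t j` with `j ∈ s`. -/
def exchangeTerm (c : ℂ) (x : ι → ℂ) (w : ι → ι → ℂ) (b t : ι → A) (s : Finset ι) (o i : ι) : A :=
  (g c (x i) (x o) * ∏ j ∈ s.erase i, w i j * f c (x j) (x i)) •
    (t o * wprod w t (s.erase i) * b i)

variable {ε : ℂ} {w : ι → ι → ℂ} {b t : ι → A} {s : Finset ι} {o : ι}

theorem exchangeTerm_insert_self {j : ι} (hj : j ∉ s) :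
    exchangeTerm c x w b t (insert j s) o j
      = (g c (x j) (x o) * ((∏ k ∈ s, w j k) * ∏ k ∈ s, f c (x k) (x j))) •
        (t o * wprod w t s * b j) := by
  rw [exchangeTerm, erase_insert hj, prod_mul_distrib]

theorem exchangeTerm_insert_of_mem (hx : Function.Injective x) {i j : ι} (hj : j ∉ s)
    (ht : SelfExchanges c x ε w t (insert j s)) (hoj : j ≠ o) (hoi : i ≠ o) (hi : i ∈ s) :
    exchangeTerm c x w b t (insert j s) o i
      = (∏ k ∈ s, w j k) • (f c (x j) (x o) • (t j * exchangeTerm c x w b t s o i)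
        - g c (x j) (x o) • (t o * exchangeTerm c x w b t s j i)) := by
  have hij : i ≠ j := ne_of_mem_of_not_mem hi hj
  have hji : j ∉ s.erase i := fun h => hj (mem_of_mem_erase h)
  have hsub : insert j (s.erase i) ⊆ insert j s := insert_subset_insert _ (erase_subset _ _)
  have hswap (p : ℂ) (z : A) : f c (x j) (x o) • (t j * p • (t o * z))
      = (p * (g c (x j) (x o) + ε)) • (t o * (t j * z)) := by
    rw [mul_smul_comm, ← mul_assoc, smul_comm, ← smul_mul_assoc, ht.f_smul_mul j o hoj,
      smul_mul_assoc, mul_smul, mul_assoc]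
  have hcoeff : g c (x i) (x o) * (w i j * f c (x j) (x i))
      = w j i * (g c (x i) (x o) * (g c (x j) (x o) + ε)
        - g c (x j) (x o) * g c (x i) (x j)) := by
    linear_combination g c (x i) (x o) *
        ht.weight_mul_f i (mem_insert_of_mem hi) j (mem_insert_self _ _) hij
      + w j i * g_mul_g (c := c) (hx.ne hij.symm) (hx.ne hoi) (hx.ne hoj)
      + w j i * g c (x j) (x o) * g_swap (c := c) (x i) (x j)
  rw [exchangeTerm, exchangeTerm, exchangeTerm, mul_assoc (t o) (wprod w t (s.erase i)), hswap,
    erase_insert_of_ne hij.symm, wprod_insert_left hji (ht.weightCommute.mono hsub),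
    prod_insert hji, ← mul_prod_erase s (w j) hi]
  simp only [mul_smul_comm, smul_mul_assoc, smul_smul, mul_assoc, ← sub_smul]
  congr 1
  linear_combination (∏ k ∈ s.erase i, w i k * f c (x k) (x i)) *
    (∏ k ∈ s.erase i, w j k) * hcoeff

theorem mul_wprod (hx : Function.Injective x) (hbt : Exchanges c x b t)
    (ht : SelfExchanges c x ε w t s) (ho : o ∉ s) :
    b o * wprod w t s = (∏ i ∈ s, f c (x i) (x o)) • (wprod w t s * b o)
      - ∑ i ∈ s, exchangeTerm c x w b t s o i := by
  induction s using Finset.induction_on generalizing o with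
  | empty => simp
  | insert j s hj ih =>
    obtain ⟨hoj, hos⟩ : o ≠ j ∧ o ∉ s := by simpa using ho
    have ih' {o : ι} (ho : o ∉ s) : ∑ i ∈ s, exchangeTerm c x w b t s o i
        = (∏ i ∈ s, f c (x i) (x o)) • (wprod w t s * b o) - b o * wprod w t s := by
      rw [ih (ht.mono (subset_insert _ _)) ho, sub_sub_cancel]
    have hterms : ∑ i ∈ s, exchangeTerm c x w b t (insert j s) o i = _ :=
      sum_congr rfl fun i hi => exchangeTerm_insert_of_mem hx hj ht hoj.symm
        (ne_of_mem_of_not_mem hi hos) hi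
    rw [sum_insert hj, exchangeTerm_insert_self hj, hterms, ← smul_sum, sum_sub_distrib,
      ← smul_sum, ← smul_sum, ← mul_sum, ← mul_sum, ih' hos, ih' hj, prod_insert hj,
      wprod_insert_left hj ht.weightCommute, mul_smul_comm, ← mul_assoc, hbt o j hoj]
    simp only [sub_mul, mul_sub, smul_sub, mul_smul_comm, smul_mul_assoc, smul_smul, mul_assoc]
    rw [mul_left_comm (∏ k ∈ s, w j k), mul_left_comm (∏ k ∈ s, w j k),
      mul_comm (∏ k ∈ s, w j k) (∏ i ∈ s, f c (x i) (x o))]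
    abel

end Exchange

section OppositeExchange

variable {ι A : Type*} [LinearOrder ι] [Ring A] [Algebra ℂ A] {c : ℂ} {x : ι → ℂ}

theorem wprod_one_mul (hx : Function.Injective x) {a d : ι → A}
    (hda : ∀ i j, i ≠ j →
      d i * a j = f c (x i) (x j) • (a j * d i) - g c (x i) (x j) • (a i * d j))
    (hdd : ∀ i j, d i * d j = d j * d i) {s : Finset ι} {o : ι} (ho : o ∉ s) :
    wprod 1 d s * a o = (∏ i ∈ s, f c (x i) (x o)) • (a o * wprod 1 d s)
      - ∑ i ∈ s, (g c (x i) (x o) * ∏ j ∈ s.erase i, f c (x j) (x i)) •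
          (a i * wprod 1 d (s.erase i) * d o) := by
  let d' : ι → Aᵐᵒᵖ := fun i => .op (d i)
  have hdd' : ∀ i j, d' i * d' j = d' j * d' i := fun i j => congrArg MulOpposite.op (hdd j i)
  have hda' : Exchanges c x (fun i => MulOpposite.op (a i)) d' := fun i j hij =>
    congrArg MulOpposite.op (hda j i hij.symm)
  have hd' : SelfExchanges c x 1 1 d' s :=
    { weightCommute := weightCommute_one hdd' s
      f_smul_mul := fun i j hij => by rw [f_eq_one_add_g (hx.ne hij), add_comm, hdd' i j]
      weight_mul_f := fun i _ j _ hij => by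
        simp only [Pi.one_apply, one_mul, f_eq_one_add_g (hx.ne hij.symm), add_comm] }
  have hunop (r : Finset ι) : (wprod 1 d' r).unop = wprod 1 d r :=
    unop_wprod (weightCommute_one hdd' r)
  have key := congrArg MulOpposite.unop (mul_wprod hx hda' hd' ho)
  have hd (i : ι) : (d' i).unop = d i := rfl
  simpa only [exchangeTerm, MulOpposite.unop_sub, Finset.unop_sum, MulOpposite.unop_smul,
    MulOpposite.unop_mul, MulOpposite.unop_op, hunop, hd, Pi.one_apply, one_mul,
    mul_assoc] using key

end OppositeExchange

section Residues

variable {ι : Type*} {c : ℂ} {x : ι → ℂ}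

open Polynomial in
theorem sum_prod_h_mul_prod_g_eq_zero [DecidableEq ι] {κ : Type*} (hx : Function.Injective x)
    (y : κ → ℂ) {R : Finset κ} {S : Finset ι} (hcard : #R + 1 < #S) :
    ∑ i ∈ S, (∏ k ∈ R, h c (x i) (y k)) * ∏ j ∈ S.erase i, g c (x i) (x j) = 0 := by
  let P : ℂ[X] := ∏ k ∈ R, (X - C (y k - c))
  have hP : P.natDegree = #R := by
    rw [natDegree_prod_of_monic _ _ fun k _ => monic_X_sub_C _]
    simp only [natDegree_X_sub_C, sum_const, smul_eq_mul, mul_one]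
  have heval (i : ι) : ∏ k ∈ R, h c (x i) (y k) = P.eval (x i) / c ^ #R := by
    simp only [h, P, eval_prod, eval_sub, eval_X, eval_C, prod_div_distrib, prod_const,
      sub_sub_eq_add_sub, sub_add_eq_add_sub]
  have hg (i : ι) (hi : i ∈ S) : ∏ j ∈ S.erase i, g c (x i) (x j)
      = c ^ (#S - 1) / ∏ j ∈ S.erase i, (x i - x j) := by
    simp only [g, prod_div_distrib, prod_const, card_erase_of_mem hi]
  have hlagrange : ∑ i ∈ S, P.eval (x i) / ∏ j ∈ S.erase i, (x i - x j) = 0 := by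
    rw [← Lagrange.coeff_eq_sum hx.injOn
      (degree_le_natDegree.trans_lt (by exact_mod_cast (by omega : P.natDegree < #S)))]
    exact coeff_eq_zero_of_natDegree_lt (by omega)
  calc _ = ∑ i ∈ S, c ^ (#S - 1) / c ^ #R * (P.eval (x i) / ∏ j ∈ S.erase i, (x i - x j)) :=
        sum_congr rfl fun i hi => by rw [heval, hg i hi]; ring
    _ = 0 := by rw [← mul_sum, hlagrange, mul_zero]

theorem sum_residues [DecidableEq ι] (hc : c ≠ 0) (hx : Function.Injective x) {α B γ : Finset ι}
    (hγB : Disjoint γ B) (hcard : #α + 1 < #B) :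
    ∑ i ∈ γ, (∏ k ∈ α, h c (x i) (x k)) * (∏ k ∈ B, g c (x i) (x k)) *
        ∏ k ∈ γ.erase i, f c (x i) (x k)
      + ∑ i ∈ B, (∏ k ∈ α, h c (x i) (x k)) * (∏ k ∈ B.erase i, g c (x i) (x k)) *
        ∏ k ∈ γ, f c (x i) (x k) = 0 := by
  have hsum := sum_prod_h_mul_prod_g_eq_zero (c := c) hx (Sum.elim x x) (R := γ.disjSum α)
    (S := γ ∪ B) (by rw [card_disjSum, card_union_of_disjoint hγB]; omega)
  rw [sum_union hγB] at hsum
  rw [← hsum]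
  simp only [prod_disjSum, Sum.elim_inl, Sum.elim_inr, f_eq_g_mul_h hc, prod_mul_distrib]
  refine congrArg₂ _ (sum_congr rfl fun i hi => ?_) (sum_congr rfl fun i hi => ?_)
  · have hiB : i ∉ B := disjoint_left.mp hγB hi
    rw [erase_union_distrib, erase_eq_of_notMem hiB,
      prod_union (hγB.mono_left (erase_subset _ _)),
      ← mul_prod_erase γ (fun k => h c (x i) (x k)) hi, h_self hc]
    ring
  · have hiγ : i ∉ γ := disjoint_right.mp hγB hi
    rw [erase_union_distrib, erase_eq_of_notMem hiγ,
      prod_union (hγB.mono_right (erase_subset _ _))]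
    ring

theorem sum_residues_swap [DecidableEq ι] (hc : c ≠ 0) (hx : Function.Injective x)
    {α B γ : Finset ι} (hγB : Disjoint γ B) (hcard : #α + 1 < #B) :
    ∑ i ∈ γ, (∏ k ∈ α, h c (x k) (x i)) * (∏ k ∈ B, g c (x k) (x i)) *
        ∏ k ∈ γ.erase i, f c (x k) (x i)
      + ∑ i ∈ B, (∏ k ∈ α, h c (x k) (x i)) * (∏ k ∈ B.erase i, g c (x k) (x i)) *
        ∏ k ∈ γ, f c (x k) (x i) = 0 := by
  simpa only [h_neg, g_neg, f_neg] using sum_residues (neg_ne_zero.mpr hc) hx hγB hcard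

theorem sum_residues_pair [DecidableEq ι] (hc : c ≠ 0) (hx : Function.Injective x) {γ : Finset ι}
    {o p : ι} (hop : o ≠ p) (hoγ : o ∉ γ) (hpγ : p ∉ γ) :
    g c (x p) (x o) * (∏ k ∈ γ, f c (x o) (x k))
      + ∑ i ∈ γ, g c (x i) (x o) * g c (x p) (x i) * ∏ k ∈ γ.erase i, f c (x i) (x k)
      = g c (x p) (x o) * ∏ k ∈ γ, f c (x p) (x k) := by
  have hdisj : Disjoint γ {o, p} := by simp [hoγ, hpγ]
  have key := sum_residues (α := ∅) hc hx hdisj (by simp [hop])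
  rw [sum_pair hop, erase_insert (by simpa using hop), pair_comm,
    erase_insert (by simpa using hop.symm)] at key
  simp only [prod_empty, one_mul, prod_singleton, prod_pair hop.symm] at key
  have hterm (i : ι) : g c (x i) (x o) * g c (x p) (x i) * ∏ k ∈ γ.erase i, f c (x i) (x k)
      = - (g c (x i) (x p) * g c (x i) (x o) * ∏ k ∈ γ.erase i, f c (x i) (x k)) := by
    rw [g_swap (x i) (x p)]; ring
  rw [sum_congr rfl fun i _ => hterm i, sum_neg_distrib]
  linear_combination (∏ k ∈ γ, f c (x o) (x k)) * g_swap (c := c) (x o) (x p) - key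

theorem sum_residues_pair_swap [DecidableEq ι] (hc : c ≠ 0) (hx : Function.Injective x)
    {γ : Finset ι} {o p : ι} (hop : o ≠ p) (hoγ : o ∉ γ) (hpγ : p ∉ γ) :
    g c (x p) (x o) * (∏ k ∈ γ, f c (x k) (x o))
      - ∑ i ∈ γ, g c (x i) (x o) * g c (x p) (x i) * ∏ k ∈ γ.erase i, f c (x k) (x i)
      = g c (x p) (x o) * ∏ k ∈ γ, f c (x k) (x p) := by
  have key := sum_residues_pair (neg_ne_zero.mpr hc) hx hop hoγ hpγ
  simp only [g_neg, f_neg] at key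
  have hterm (i : ι) : g c (x o) (x i) * g c (x i) (x p) * ∏ k ∈ γ.erase i, f c (x k) (x i)
      = g c (x i) (x o) * g c (x p) (x i) * ∏ k ∈ γ.erase i, f c (x k) (x i) := by
    rw [g_swap (x i) (x o), g_swap (x p) (x i), neg_mul_neg]
  rw [sum_congr rfl fun i _ => hterm i, g_swap (x p) (x o)] at key
  linear_combination -key

end Residues

section DomainWall

theorem prod_Ioi_eq_succAbove {n : ℕ} {G : Fin (n + 1) → Fin (n + 1) → ℂ}
    (hG : ∀ j k, G j k = -G k j) (i : Fin (n + 1)) :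
    ∏ j, ∏ k ∈ Ioi j, G j k = (-1) ^ (i : ℕ) * ((∏ l, G i (i.succAbove l)) *
      ∏ j, ∏ k ∈ Ioi j, G (i.succAbove j) (i.succAbove k)) := by
  have hperm := Equiv.Perm.prod_Ioi_comp_eq_sign_mul_prod i.cycleRange.symm hG
  have hsign : ((-1) ^ (i : ℕ) : ℂ) * (-1) ^ (i : ℕ) = 1 := by rw [← mul_pow]; simp
  rw [Fin.prod_univ_succ, Equiv.Perm.sign_symm, Fin.sign_cycleRange] at hperm
  simp only [Fin.prod_Ioi_zero, Fin.prod_Ioi_succ, Fin.cycleRange_symm_zero,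
    Fin.cycleRange_symm_succ, Units.val_pow_eq_pow_val, Units.val_neg, Units.val_one,
    Int.cast_pow, Int.cast_neg, Int.cast_one] at hperm
  rw [hperm, ← mul_assoc, hsign, one_mul]

theorem dwpf_eq_prod_Ioi (c : ℂ) {n : ℕ} (x y : Fin n → ℂ) :
    dwpf c x y = (∏ j, ∏ k ∈ Ioi j, g c (x j) (x k)) * (∏ j, ∏ k ∈ Ioi j, g c (y k) (y j)) *
      (∏ j, ∏ k, h c (x j) (y k)) *
      Matrix.det (Matrix.of fun j k => g c (x j) (y k) / h c (x j) (y k)) := by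
  have hswap : ∏ j, ∏ k ∈ Iio j, g c (y j) (y k) = ∏ k, ∏ j ∈ Ioi k, g c (y j) (y k) :=
    prod_comm' (by simp)
  simp only [dwpf, filter_lt_eq_Ioi, filter_gt_eq_Iio, hswap]

theorem dwpf_comp_perm (c : ℂ) {n : ℕ} (x y : Fin n → ℂ) (σ τ : Equiv.Perm (Fin n)) :
    dwpf c (x ∘ σ) (y ∘ τ) = dwpf c x y := by
  have hx := σ.prod_Ioi_comp_eq_sign_mul_prod fun j k => g_swap (c := c) (x k) (x j)
  have hy := τ.prod_Ioi_comp_eq_sign_mul_prod fun j k => g_swap (c := c) (y j) (y k)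
  have hh : ∏ j, ∏ k, h c (x (σ j)) (y (τ k)) = ∏ j, ∏ k, h c (x j) (y k) := by
    rw [Equiv.prod_comp σ fun j => ∏ k, h c (x j) (y (τ k))]
    exact prod_congr rfl fun j _ => Equiv.prod_comp τ fun k => h c (x j) (y k)
  let M : Matrix (Fin n) (Fin n) ℂ := Matrix.of fun j k => g c (x j) (y k) / h c (x j) (y k)
  have hdet : (M.submatrix σ τ).det = (σ.sign : ℤ) * ((τ.sign : ℤ) * M.det) := by
    rw [← Matrix.det_permute' τ M, ← Matrix.det_permute σ]; rfl
  have hsign (π : Equiv.Perm (Fin n)) : ((π.sign : ℤ) : ℂ) * (π.sign : ℤ) = 1 := by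
    rw [← Int.cast_mul, Int.units_coe_mul_self, Int.cast_one]
  rw [dwpf_eq_prod_Ioi, dwpf_eq_prod_Ioi]
  simp only [Function.comp_apply]
  rw [hx, hy, hh]
  change _ * _ * _ * (M.submatrix σ τ).det = _ * M.det
  rw [hdet]
  linear_combination (∏ j, ∏ k ∈ Ioi j, g c (x j) (x k)) * (∏ j, ∏ k ∈ Ioi j, g c (y k) (y j)) *
      (∏ j, ∏ k, h c (x j) (y k)) * M.det * ((τ.sign : ℤ) * (τ.sign : ℤ) * hsign σ + hsign τ)

/-- The domain wall partition function `K(x̄_β | ȳ_α)` of the subsets indexed by `β` and `α`, in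
their natural order; zero if the two sets have different sizes. -/
def dwpfOn {ι κ : Type*} [LinearOrder ι] [LinearOrder κ] (c : ℂ) (x : ι → ℂ) (y : κ → ℂ)
    (β : Finset ι) (α : Finset κ) : ℂ :=
  if hcard : #β = #α then
    dwpf c (fun i => x (β.orderEmbOfFin hcard i)) fun i => y (α.orderEmbOfFin rfl i)
  else 0

theorem dwpfOn_eq {ι κ : Type*} [LinearOrder ι] [LinearOrder κ] (c : ℂ) (x : ι → ℂ) (y : κ → ℂ)
    {β : Finset ι} {α : Finset κ} {n : ℕ} (hβ : #β = n) (hα : #α = n) :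
    dwpfOn c x y β α = dwpf c (x ∘ β.orderEmbOfFin hβ) (y ∘ α.orderEmbOfFin hα) := by
  subst hα
  exact dif_pos hβ

theorem dwpfOn_of_card_ne {ι κ : Type*} [LinearOrder ι] [LinearOrder κ] (c : ℂ) (x : ι → ℂ)
    (y : κ → ℂ) {β : Finset ι} {α : Finset κ} (hne : #β ≠ #α) : dwpfOn c x y β α = 0 :=
  dif_neg hne

theorem exists_eq_orderEmbOfFin_comp {ι : Type*} [LinearOrder ι] {s : Finset ι} {n : ℕ}
    (hs : #s = n) {e : Fin n ↪ ι} (he : univ.map e = s) :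
    ∃ σ : Equiv.Perm (Fin n), e = s.orderEmbOfFin hs ∘ σ := by
  have hmem (i : Fin n) : e i ∈ s := he ▸ mem_map_of_mem e (mem_univ i)
  have hinj : Function.Injective fun i => (s.orderIsoOfFin hs).symm ⟨e i, hmem i⟩ :=
    fun i j hij => by simpa using hij
  exact ⟨.ofBijective _ (Finite.injective_iff_bijective.mp hinj), funext fun i => by
    simp [← coe_orderIsoOfFin_apply]⟩

theorem dwpfOn_map_univ {ι κ : Type*} [LinearOrder ι] [LinearOrder κ] (c : ℂ) (x : ι → ℂ)
    (y : κ → ℂ) {n : ℕ} (e : Fin n ↪ ι) (e' : Fin n ↪ κ) :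
    dwpfOn c x y (univ.map e) (univ.map e') = dwpf c (x ∘ e) (y ∘ e') := by
  obtain ⟨σ, hσ⟩ := exists_eq_orderEmbOfFin_comp (by simp) (rfl : univ.map e = _)
  obtain ⟨τ, hτ⟩ := exists_eq_orderEmbOfFin_comp (by simp) (rfl : univ.map e' = _)
  rw [dwpfOn_eq c x y (n := n) (by simp) (by simp), hσ, hτ, ← Function.comp_assoc,
    ← Function.comp_assoc, dwpf_comp_perm]

variable {ι : Type*} [LinearOrder ι]

/-- The cofactor expansion of `K(x̄_β | z, x̄_α)` along the column of `z`, without the factor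
`g(x̄_α, z)`. -/
def columnSum (c : ℂ) (x : ι → ℂ) (β α : Finset ι) (z : ℂ) : ℂ :=
  ∑ j ∈ β, (∏ l ∈ β.erase j, g c (x j) (x l)) * (∏ k ∈ α, h c (x j) (x k)) *
    (∏ l ∈ β.erase j, h c (x l) z) * g c (x j) z * dwpfOn c x x (β.erase j) α

theorem map_univ_erase {n : ℕ} (e : Fin (n + 1) ↪ ι) (j : Fin (n + 1)) :
    (univ.map e).erase (e j) = univ.map (j.succAboveEmb.trans e) := by
  ext k
  simp only [mem_erase, mem_map, mem_univ, true_and, Function.Embedding.trans_apply,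
    Fin.coe_succAboveEmb]
  constructor
  · rintro ⟨hne, m, rfl⟩
    obtain ⟨l, rfl⟩ := Fin.exists_succAbove_eq (ne_of_apply_ne e hne)
    exact ⟨l, rfl⟩
  · rintro ⟨l, rfl⟩
    exact ⟨e.injective.ne (Fin.succAbove_ne j l), _, rfl⟩

theorem columnSum_map_univ (c : ℂ) (x : ι → ℂ) {n : ℕ} (e : Fin (n + 1) ↪ ι) (e' : Fin n ↪ ι)
    {z : ℂ} (hz : ∀ j, h c (x (e j)) z ≠ 0) :
    columnSum c x (univ.map e) (univ.map e') z
      = (∏ j, ∏ k ∈ Ioi j, g c (x (e j)) (x (e k))) *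
        (∏ j, ∏ k ∈ Ioi j, g c (x (e' k)) (x (e' j))) *
        (∏ j, h c (x (e j)) z * ∏ k, h c (x (e j)) (x (e' k))) *
        Matrix.det (Matrix.of fun j k => g c (x (e j)) ((Fin.cons z (x ∘ e') : Fin (n + 1) → ℂ) k) /
          h c (x (e j)) ((Fin.cons z (x ∘ e') : Fin (n + 1) → ℂ) k)) := by
  rw [Matrix.det_succ_column_zero, mul_sum, columnSum, sum_map]
  refine sum_congr rfl fun j _ => ?_
  have hminor : ((Matrix.of fun j k => g c (x (e j)) ((Fin.cons z (x ∘ e') : Fin (n + 1) → ℂ) k) /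
      h c (x (e j)) ((Fin.cons z (x ∘ e') : Fin (n + 1) → ℂ) k)).submatrix j.succAbove Fin.succ)
      = Matrix.of fun l k => g c (x (e (j.succAbove l))) (x (e' k)) /
        h c (x (e (j.succAbove l))) (x (e' k)) := by
    ext l k; simp
  rw [map_univ_erase, dwpfOn_map_univ, dwpf_eq_prod_Ioi,
    prod_Ioi_eq_succAbove (fun i k => g_swap _ _) j, Fin.prod_univ_succAbove _ j, hminor]
  simp only [prod_mul_distrib, Matrix.of_apply, prod_map, Fin.cons_zero, Function.comp_apply,
    Function.Embedding.trans_apply, Fin.coe_succAboveEmb]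
  have hg : g c (x (e j)) z = ((-1) ^ (j : ℕ) * (-1) ^ (j : ℕ)) *
      (h c (x (e j)) z * (g c (x (e j)) z / h c (x (e j)) z)) := by
    rw [mul_div_cancel₀ _ (hz j), ← mul_pow]; simp
  conv_lhs => rw [hg]
  ring

theorem exists_map_univ_eq {s : Finset ι} {n : ℕ} (hs : #s = n) :
    ∃ e : Fin n ↪ ι, univ.map e = s :=
  ⟨(s.orderEmbOfFin hs).toEmbedding, map_orderEmbOfFin_univ s hs⟩

theorem dwpfOn_insert_eq_columnSum {c : ℂ} {x : ι → ℂ} {α β : Finset ι} {o : ι} (ho : o ∉ α)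
    (hcard : #β = #α + 1) (hh : ∀ j ∈ β, h c (x j) (x o) ≠ 0) :
    dwpfOn c x x β (insert o α) = (∏ k ∈ α, g c (x k) (x o)) * columnSum c x β α (x o) := by
  obtain ⟨n, hn⟩ : ∃ n, #α = n := ⟨_, rfl⟩
  obtain ⟨e', rfl⟩ := exists_map_univ_eq hn
  obtain ⟨e, rfl⟩ := exists_map_univ_eq (hn ▸ hcard)
  have ho' : o ∉ Set.range e' := by simpa using ho
  have hinsert : insert o (univ.map e') = univ.map (Fin.Embedding.cons e' ho') := by
    ext k; simp [Fin.exists_fin_succ, eq_comm]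
  let w : Fin (n + 1) → ℂ := Fin.cons (x o) (x ∘ e')
  have hw : x ∘ Fin.Embedding.cons e' ho' = w := by
    funext k; cases k using Fin.cases <;> rfl
  have hg : ∏ j, ∏ k ∈ Ioi j, g c (w k) (w j)
      = (∏ k, g c (x (e' k)) (x o)) * ∏ j, ∏ k ∈ Ioi j, g c (x (e' k)) (x (e' j)) := by
    rw [Fin.prod_univ_succ]
    simp only [Fin.prod_Ioi_zero, Fin.prod_Ioi_succ]
    rfl
  have hh' (j) : ∏ k, h c (x (e j)) (w k) = h c (x (e j)) (x o) * ∏ k, h c (x (e j)) (x (e' k)) :=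
    Fin.prod_univ_succ _
  rw [hinsert, dwpfOn_map_univ, columnSum_map_univ _ _ _ _ fun j => hh _ (by simp),
    dwpf_eq_prod_Ioi, hw, hg, prod_map]
  simp only [Function.comp_apply, hh']
  ring

theorem columnSum_eq_zero {c : ℂ} {x : ι → ℂ} {α β : Finset ι} {k : ι} (hcard : #β = #α + 1)
    (hk : k ∈ α) (hh : ∀ j ∈ β, h c (x j) (x k) ≠ 0) : columnSum c x β α (x k) = 0 := by
  obtain ⟨n, hn⟩ : ∃ n, #α = n := ⟨_, rfl⟩
  obtain ⟨e', rfl⟩ := exists_map_univ_eq hn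
  obtain ⟨e, rfl⟩ := exists_map_univ_eq (hn ▸ hcard)
  obtain ⟨l, -, rfl⟩ := mem_map.mp hk
  rw [columnSum_map_univ _ _ _ _ fun j => hh _ (by simp),
    Matrix.det_zero_of_column_eq (Fin.succ_ne_zero l), mul_zero]
  simp

variable {c : ℂ} {x : ι → ℂ} {α β : Finset ι} {o : ι}

theorem prod_f_eq_prod_g_swap (hc : c ≠ 0) {j : ι} (hcard : #(β.erase j) = #α) :
    (∏ k ∈ α, f c (x j) (x k)) * ∏ l ∈ β.erase j, f c (x l) (x j)
      = (∏ k ∈ α, g c (x k) (x j)) * (∏ k ∈ α, h c (x j) (x k)) *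
        ((∏ l ∈ β.erase j, g c (x j) (x l)) * ∏ l ∈ β.erase j, h c (x l) (x j)) := by
  have hflip (s : Finset ι) :
      ∏ k ∈ s, g c (x j) (x k) = (-1) ^ #s * ∏ k ∈ s, g c (x k) (x j) := by
    rw [← prod_neg]
    exact prod_congr rfl fun k _ => g_swap _ _
  simp only [f_eq_g_mul_h hc, prod_mul_distrib, hflip, hcard]
  ring

theorem sum_prod_g_mul_columnSum (hc : c ≠ 0) (hx : Function.Injective x) (hoα : o ∉ α)
    (hoβ : o ∉ β) (hαβ : Disjoint α β) (hcard : #β = #α + 1) :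
    (∏ k ∈ α, g c (x k) (x o)) * columnSum c x β α (x o)
      + ∑ i ∈ α, g c (x o) (x i) * (∏ k ∈ α.erase i, g c (x k) (x i)) * columnSum c x β α (x i)
      = ∑ j ∈ β, g c (x j) (x o) * (∏ k ∈ α, f c (x j) (x k)) *
        (∏ l ∈ β.erase j, f c (x l) (x j)) * dwpfOn c x x (β.erase j) α := by
  simp only [columnSum, mul_sum]
  rw [sum_comm, ← sum_add_distrib]
  refine sum_congr rfl fun j hj => ?_
  have hjα : j ∉ α := disjoint_right.mp hαβ hj
  have hoj : o ≠ j := ne_of_mem_of_not_mem hj hoβ |>.symm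
  have hoS : o ∉ insert j α := by simp [hoα, hoj]
  have hcard' : #(β.erase j) = #α := by rw [card_erase_of_mem hj, hcard, Nat.add_sub_cancel]
  have hα (i) (hi : i ∈ α) : ∏ k ∈ (insert o (insert j α)).erase i, g c (x k) (x i)
      = g c (x o) (x i) * (g c (x j) (x i) * ∏ k ∈ α.erase i, g c (x k) (x i)) := by
    rw [erase_insert_of_ne (ne_of_mem_of_not_mem hi hoα).symm,
      erase_insert_of_ne (ne_of_mem_of_not_mem hi hjα).symm,
      prod_insert (by simp [hoα, hoj]), prod_insert (by simp [hjα])]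
  have key := sum_residues_swap (α := β.erase j) (B := insert o (insert j α)) hc hx
    (disjoint_empty_left _) (by rw [card_insert_of_notMem hoS, card_insert_of_notMem hjα]; omega)
  rw [sum_empty, zero_add, sum_insert hoS, sum_insert hjα, erase_insert hoS, prod_insert hjα,
    erase_insert_of_ne hoj, erase_insert hjα, prod_insert hoα] at key
  simp only [prod_empty, mul_one] at key
  have hterm (i) (hi : i ∈ α) : g c (x o) (x i) * (∏ k ∈ α.erase i, g c (x k) (x i)) *
        ((∏ l ∈ β.erase j, g c (x j) (x l)) * (∏ k ∈ α, h c (x j) (x k)) *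
          (∏ l ∈ β.erase j, h c (x l) (x i)) * g c (x j) (x i) * dwpfOn c x x (β.erase j) α)
      = (∏ l ∈ β.erase j, g c (x j) (x l)) * (∏ k ∈ α, h c (x j) (x k)) *
          dwpfOn c x x (β.erase j) α * ((∏ l ∈ β.erase j, h c (x l) (x i)) *
            ∏ k ∈ (insert o (insert j α)).erase i, g c (x k) (x i)) := by
    rw [hα i hi]; ring
  rw [sum_congr rfl hterm, ← mul_sum]
  linear_combination (∏ l ∈ β.erase j, g c (x j) (x l)) * (∏ k ∈ α, h c (x j) (x k)) *
      dwpfOn c x x (β.erase j) α * key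
    - g c (x j) (x o) * dwpfOn c x x (β.erase j) α *
      prod_f_eq_prod_g_swap (c := c) (x := x) hc hcard'
    - (∏ l ∈ β.erase j, g c (x j) (x l)) * (∏ k ∈ α, h c (x j) (x k)) *
      dwpfOn c x x (β.erase j) α * (∏ l ∈ β.erase j, h c (x l) (x j)) *
      (∏ k ∈ α, g c (x k) (x j)) * g_swap (c := c) (x j) (x o)

theorem dwpfOn_insert (hc : c ≠ 0) (hx : Function.Injective x) (hoα : o ∉ α) (hoβ : o ∉ β)
    (hαβ : Disjoint α β) (hh : ∀ j ∈ β, ∀ k ∈ insert o α, h c (x j) (x k) ≠ 0) :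
    dwpfOn c x x β (insert o α) = ∑ j ∈ β, g c (x j) (x o) * (∏ k ∈ α, f c (x j) (x k)) *
      (∏ l ∈ β.erase j, f c (x l) (x j)) * dwpfOn c x x (β.erase j) α := by
  by_cases hcard : #β = #α + 1
  · rw [dwpfOn_insert_eq_columnSum hoα hcard fun j hj => hh j hj o (mem_insert_self _ _),
      ← sum_prod_g_mul_columnSum hc hx hoα hoβ hαβ hcard, left_eq_add]
    exact sum_eq_zero fun i hi => by
      rw [columnSum_eq_zero hcard hi fun j hj => hh j hj i (mem_insert_of_mem hi), mul_zero]
  · rw [dwpfOn_of_card_ne _ _ _ (by rwa [card_insert_of_notMem hoα]), sum_eq_zero]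
    intro j hj
    have hpos := card_pos.mpr ⟨j, hj⟩
    rw [dwpfOn_of_card_ne _ _ _ (by rw [card_erase_of_mem hj]; omega), mul_zero]

end DomainWall

section Reindexing

variable {ι M : Type*} [DecidableEq ι] [AddCommMonoid M]

theorem sum_powerset_sum_erase (U : Finset ι) (F : Finset ι → ι → M) :
    ∑ α ∈ U.powerset, ∑ i ∈ α, F (α.erase i) i = ∑ α ∈ U.powerset, ∑ i ∈ U \ α, F α i := by
  rw [sum_sigma', sum_sigma']
  refine sum_bij' (fun p _ => ⟨p.1.erase p.2, p.2⟩) (fun p _ => ⟨insert p.2 p.1, p.2⟩)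
    ?_ ?_ ?_ ?_ fun _ _ => rfl
  · rintro ⟨α, i⟩ hp
    simp only [mem_sigma, mem_powerset, mem_sdiff] at hp ⊢
    exact ⟨(erase_subset _ _).trans hp.1, hp.1 hp.2, notMem_erase _ _⟩
  · rintro ⟨α, i⟩ hp
    simp only [mem_sigma, mem_powerset, mem_sdiff] at hp ⊢
    exact ⟨insert_subset hp.2.1 hp.1, mem_insert_self _ _⟩
  · rintro ⟨α, i⟩ hp
    simp only [mem_sigma] at hp
    simp only [insert_erase hp.2]
  · rintro ⟨α, i⟩ hp
    simp only [mem_sigma, mem_sdiff] at hp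
    simp only [erase_insert hp.2.2]

theorem sum_powerset_sum_mem (V : Finset ι) (F : Finset ι → ι → M) :
    ∑ β ∈ V.powerset, ∑ j ∈ β, F (β.erase j) j = ∑ j ∈ V, ∑ β ∈ (V.erase j).powerset, F β j := by
  rw [sum_powerset_sum_erase]
  refine sum_comm' fun β j => ?_
  simp only [mem_powerset, mem_sdiff, subset_erase]
  tauto

theorem sum_powerset_insert_smul [Module ℂ M] {U : Finset ι} {o : ι} (hoU : o ∉ U)
    {P P₀ P₁ : Finset ι → M} {ρ : Finset ι → ι → ℂ} {σ : Finset ι → ℂ} (κ : Finset ι → ℂ)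
    (hP : ∀ α ⊆ U, P α = P₀ α + ∑ i ∈ α, ρ (α.erase i) i • P₁ (α.erase i))
    (hPo : ∀ α ⊆ U, P (insert o α) = σ α • P₁ α) :
    ∑ α ∈ (insert o U).powerset, κ α • P α = ∑ α ∈ U.powerset, κ α • P₀ α
      + ∑ α ∈ U.powerset,
        (κ (insert o α) * σ α + ∑ i ∈ U \ α, κ (insert i α) * ρ α i) • P₁ α := by
  have hterm (α : Finset ι) (hα : α ⊆ U) : κ α • P α = κ α • P₀ α
      + ∑ i ∈ α, (κ (insert i (α.erase i)) * ρ (α.erase i) i) • P₁ (α.erase i) := by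
    rw [hP α hα, smul_add, smul_sum]
    exact congrArg _ (sum_congr rfl fun i hi => by rw [insert_erase hi, smul_smul])
  have hterm' (α : Finset ι) (hα : α ⊆ U) :
      κ (insert o α) • P (insert o α) = (κ (insert o α) * σ α) • P₁ α := by
    rw [hPo α hα, smul_smul]
  rw [sum_powerset_insert hoU, sum_congr rfl fun α hα => hterm α (mem_powerset.mp hα),
    sum_congr rfl fun α hα => hterm' α (mem_powerset.mp hα), sum_add_distrib,
    sum_powerset_sum_erase U fun α i => (κ (insert i α) * ρ α i) • P₁ α]
  simp only [add_smul, sum_smul, sum_add_distrib]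
  rw [add_assoc, add_comm (∑ α ∈ U.powerset, ∑ i ∈ U \ α, _)]

theorem erase_sdiff_erase_of_mem (V : Finset ι) {β : Finset ι} {j : ι} (hj : j ∈ β) :
    V.erase j \ β.erase j = V \ β := by
  ext k
  simp only [mem_sdiff, mem_erase]
  constructor
  · rintro ⟨⟨hkj, hkV⟩, hkβ⟩
    exact ⟨hkV, fun hk => hkβ ⟨hkj, hk⟩⟩
  · rintro ⟨hkV, hkβ⟩
    exact ⟨⟨fun e => hkβ (e ▸ hj), hkV⟩, fun hk => hkβ hk.2⟩

end Reindexing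

section DoubleProducts

variable {ι κ : Type*} (φ : ℂ → ℂ → ℂ) (x : ι → ℂ) (y : κ → ℂ)

theorem prod₂_insert_left [DecidableEq ι] {i : ι} {s : Finset ι} (hi : i ∉ s) (t : Finset κ) :
    prod₂ φ x (insert i s) y t = (∏ j ∈ t, φ (x i) (y j)) * prod₂ φ x s y t :=
  prod_insert hi

theorem prod₂_insert_right [DecidableEq κ] (s : Finset ι) {j : κ} {t : Finset κ} (hj : j ∉ t) :
    prod₂ φ x s y (insert j t) = (∏ i ∈ s, φ (x i) (y j)) * prod₂ φ x s y t := by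
  rw [prod₂, prod₂, ← prod_mul_distrib]
  exact prod_congr rfl fun i _ => prod_insert hj

theorem prod₂_erase_left [DecidableEq ι] {i : ι} {s : Finset ι} (hi : i ∈ s) (t : Finset κ) :
    (∏ j ∈ t, φ (x i) (y j)) * prod₂ φ x (s.erase i) y t = prod₂ φ x s y t :=
  mul_prod_erase s (fun i => ∏ j ∈ t, φ (x i) (y j)) hi

theorem prod₂_erase_right [DecidableEq κ] (s : Finset ι) {j : κ} {t : Finset κ} (hj : j ∈ t) :
    (∏ i ∈ s, φ (x i) (y j)) * prod₂ φ x s y (t.erase j) = prod₂ φ x s y t := by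
  rw [← prod₂_insert_right φ x y s (notMem_erase j t), insert_erase hj]

theorem prod₂_sdiff_erase [DecidableEq ι] {V β : Finset ι} (hβ : β ⊆ V) {j : ι} (hj : j ∈ β) :
    (∏ k ∈ V.erase j, φ (x k) (x j)) * prod₂ φ x (V.erase j \ β.erase j) x (β.erase j)
      = (∏ k ∈ β.erase j, φ (x k) (x j)) * prod₂ φ x (V \ β) x β := by
  have hdiff := erase_sdiff_erase_of_mem V hj
  rw [hdiff, ← prod_sdiff (erase_subset_erase j hβ), hdiff, ← prod₂_erase_right φ x x (V \ β) hj]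
  ring

end DoubleProducts

section Coefficients

/-- `g(x̄_β, ȳ_α)` if the two sets have the same size, and zero otherwise. -/
def gOn {ι κ : Type*} (c : ℂ) (x : ι → ℂ) (y : κ → ℂ) (β : Finset ι) (α : Finset κ) : ℂ :=
  if #β = #α then prod₂ (g c) x β y α else 0

/-- The coefficient `g(x_j, x_o) f(x_j, x̄_U) g(x̄_{V∖j}, x_j)` of the recursions in `U`, for
`j ∈ V`. -/
def recCoeff {ι : Type*} [DecidableEq ι] (c : ℂ) (x : ι → ℂ) (o : ι) (U V : Finset ι) (j : ι) : ℂ :=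
  g c (x j) (x o) * (∏ k ∈ U, f c (x j) (x k)) * ∏ k ∈ V.erase j, g c (x k) (x j)

variable {ι : Type*} [LinearOrder ι] {c : ℂ} {x : ι → ℂ}

theorem gOn_insert {α β : Finset ι} {i : ι} (hi : i ∉ α) (hcard : #β = #α + 1) :
    gOn c x x β (insert i α)
      = (-1) ^ #β * prod₂ (g c) x β x α * ∏ k ∈ β, g c (x i) (x k) := by
  have hflip : ∏ k ∈ β, g c (x k) (x i) = (-1) ^ #β * ∏ k ∈ β, g c (x i) (x k) := by
    rw [← prod_neg]
    exact prod_congr rfl fun k _ => g_swap _ _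
  rw [gOn, if_pos (by rw [card_insert_of_notMem hi, hcard]), prod₂_insert_right _ _ _ _ hi, hflip]
  ring

theorem recCoeff_mul_gOn_erase (hc : c ≠ 0) {U α β : Finset ι} {o j : ι} (hα : α ⊆ U)
    (hoβ : o ∉ β) (hj : j ∈ β) (hcard : #β = #α + 1) :
    recCoeff c x o U β j * gOn c x x (β.erase j) α
      = - ((-1) ^ #β * prod₂ (g c) x β x α) * ((∏ k ∈ α, h c (x j) (x k)) *
        (∏ k ∈ (insert o β).erase j, g c (x j) (x k)) * ∏ k ∈ U \ α, f c (x j) (x k)) := by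
  have hflip : (-1) ^ #β * ∏ k ∈ β.erase j, g c (x j) (x k)
      = - ∏ k ∈ β.erase j, g c (x k) (x j) := by
    rw [← card_erase_add_one hj, pow_succ', neg_one_mul, neg_mul, ← prod_neg]
    simp only [← g_swap]
  rw [recCoeff, gOn, if_pos (by rw [card_erase_of_mem hj, hcard, Nat.add_sub_cancel]),
    ← prod₂_erase_left _ _ _ hj, ← prod_sdiff hα, erase_insert_of_ne
      (ne_of_mem_of_not_mem hj hoβ).symm, prod_insert (fun ho => hoβ (mem_of_mem_erase ho))]
  simp only [f_eq_g_mul_h hc _ (x _), prod_mul_distrib]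
  linear_combination (g c (x j) (x o) * (∏ k ∈ U \ α, g c (x j) (x k)) *
    (∏ k ∈ U \ α, h c (x j) (x k)) * (∏ k ∈ α, g c (x j) (x k)) *
    (∏ k ∈ α, h c (x j) (x k)) * prod₂ (g c) x (β.erase j) x α) * hflip

theorem gOn_insert_mul_add_sum (hc : c ≠ 0) (hx : Function.Injective x) {U α β : Finset ι} {o : ι}
    (hoU : o ∉ U) (hoβ : o ∉ β) (hUβ : Disjoint U β) (hα : α ⊆ U) :
    gOn c x x β (insert o α) * ((∏ k ∈ U \ α, f c (x o) (x k)) * ∏ k ∈ α, h c (x o) (x k))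
      + ∑ i ∈ U \ α, gOn c x x β (insert i α) *
          (g c (x i) (x o) * (∏ k ∈ (U \ α).erase i, f c (x i) (x k)) * ∏ k ∈ α, h c (x i) (x k))
      = ∑ j ∈ β, recCoeff c x o U β j * gOn c x x (β.erase j) α := by
  have hoα : o ∉ α := fun ho => hoU (hα ho)
  by_cases hcard : #β = #α + 1
  · have key := sum_residues (α := α) (B := insert o β) (γ := U \ α) hc hx
      (disjoint_insert_right.mpr ⟨fun ho => hoU (mem_sdiff.mp ho).1, hUβ.mono_left sdiff_subset⟩)
      (by rw [card_insert_of_notMem hoβ, hcard]; omega)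
    rw [sum_insert hoβ, erase_insert hoβ] at key
    have hterm (i : ι) (hi : i ∈ U \ α) : gOn c x x β (insert i α) *
          (g c (x i) (x o) * (∏ k ∈ (U \ α).erase i, f c (x i) (x k)) * ∏ k ∈ α, h c (x i) (x k))
        = (-1) ^ #β * prod₂ (g c) x β x α * ((∏ k ∈ α, h c (x i) (x k)) *
          (∏ k ∈ insert o β, g c (x i) (x k)) * ∏ k ∈ (U \ α).erase i, f c (x i) (x k)) := by
      rw [gOn_insert (mem_sdiff.mp hi).2 hcard, prod_insert hoβ]
      ring
    rw [gOn_insert hoα hcard, sum_congr rfl hterm, ← mul_sum,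
      sum_congr rfl fun j hj => recCoeff_mul_gOn_erase hc hα hoβ hj hcard, ← mul_sum]
    linear_combination (-1) ^ #β * prod₂ (g c) x β x α * key
  · have hgOn (i : ι) (hi : i ∉ α) : gOn c x x β (insert i α) = 0 :=
      if_neg (by rwa [card_insert_of_notMem hi])
    have hgOn' (j : ι) (hj : j ∈ β) : gOn c x x (β.erase j) α = 0 :=
      if_neg fun h => hcard (by rw [← h, card_erase_add_one hj])
    rw [hgOn o hoα, zero_mul, zero_add, sum_eq_zero fun i hi => by
      rw [hgOn i (mem_sdiff.mp hi).2, zero_mul], sum_eq_zero fun j hj => by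
      rw [hgOn' j hj, mul_zero]]

theorem dwpfOn_insert_mul_add_sum (hc : c ≠ 0) (hx : Function.Injective x) {U α β : Finset ι}
    {o : ι} (hoU : o ∉ U) (hoβ : o ∉ β) (hUβ : Disjoint U β) (hα : α ⊆ U)
    (hh : ∀ j ∈ β, ∀ k ∈ insert o U, h c (x j) (x k) ≠ 0) :
    dwpfOn c x x β (insert o α) * (∏ k ∈ U \ α, f c (x o) (x k))
      + ∑ i ∈ U \ α, dwpfOn c x x β (insert i α) *
          (g c (x i) (x o) * ∏ k ∈ (U \ α).erase i, f c (x i) (x k))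
      = ∑ j ∈ β, g c (x j) (x o) * (∏ k ∈ U, f c (x j) (x k)) *
          (∏ k ∈ β.erase j, f c (x k) (x j)) * dwpfOn c x x (β.erase j) α := by
  have hexpand (i : ι) (hi : i ∈ insert o (U \ α)) : dwpfOn c x x β (insert i α)
      = ∑ j ∈ β, g c (x j) (x i) * (∏ k ∈ α, f c (x j) (x k)) *
        (∏ l ∈ β.erase j, f c (x l) (x j)) * dwpfOn c x x (β.erase j) α := by
    have hiU : i ∈ insert o U := insert_subset_insert _ sdiff_subset hi
    have hiα : i ∉ α := fun hiα => by
      rcases mem_insert.mp hi with rfl | hi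
      exacts [hoU (hα hiα), (mem_sdiff.mp hi).2 hiα]
    have hiβ : i ∉ β := disjoint_left.mp (disjoint_insert_left.mpr ⟨hoβ, hUβ⟩) hiU
    exact dwpfOn_insert hc hx hiα hiβ (hUβ.mono_left hα) fun j hj k hk =>
      hh j hj k (insert_subset hiU (hα.trans (subset_insert _ _)) hk)
  have hterm (i : ι) (hi : i ∈ U \ α) : dwpfOn c x x β (insert i α) *
        (g c (x i) (x o) * ∏ k ∈ (U \ α).erase i, f c (x i) (x k))
      = ∑ j ∈ β, (∏ k ∈ α, f c (x j) (x k)) * (∏ l ∈ β.erase j, f c (x l) (x j)) *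
        dwpfOn c x x (β.erase j) α *
        (g c (x i) (x o) * g c (x j) (x i) * ∏ k ∈ (U \ α).erase i, f c (x i) (x k)) := by
    rw [hexpand i (mem_insert_of_mem hi), sum_mul]
    exact sum_congr rfl fun j _ => by ring
  rw [sum_congr rfl hterm, sum_comm, hexpand o (mem_insert_self _ _), sum_mul, ← sum_add_distrib]
  refine sum_congr rfl fun j hj => ?_
  have hpair := sum_residues_pair hc hx (γ := U \ α) (ne_of_mem_of_not_mem hj hoβ).symm
    (fun ho => hoU (mem_sdiff.mp ho).1)
    (fun hjU => disjoint_right.mp hUβ hj (mem_sdiff.mp hjU).1)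
  rw [← mul_sum, ← prod_sdiff hα]
  linear_combination ((∏ k ∈ α, f c (x j) (x k)) * (∏ l ∈ β.erase j, f c (x l) (x j)) *
    dwpfOn c x x (β.erase j) α) * hpair

end Coefficients

section NormalizedProducts

variable {ι A : Type*} [Ring A] [Algebra ℂ A] {c : ℂ} {x : ι → ℂ}

/-- The self-exchange relation of an odd family of entries of the monodromy matrix. -/
def OddExchanges (c : ℂ) (x : ι → ℂ) (t : ι → A) : Prop :=
  ∀ i j, i ≠ j → h c (x i) (x j) • (t i * t j) = h c (x j) (x i) • (t j * t i)

theorem OddExchanges.inv_h_smul_mul {t : ι → A} (ht : OddExchanges c x t) {i j : ι} (hne : i ≠ j)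
    (hij : h c (x i) (x j) ≠ 0) (hji : h c (x j) (x i) ≠ 0) :
    (h c (x j) (x i))⁻¹ • (t i * t j) = (h c (x i) (x j))⁻¹ • (t j * t i) := by
  rw [inv_smul_eq_iff₀ hji, smul_comm, ← ht i j hne, inv_smul_smul₀ hij]

theorem OddExchanges.f_smul_mul {t : ι → A} (ht : OddExchanges c x t) (hc : c ≠ 0)
    (hx : Function.Injective x) {i j : ι} (hne : i ≠ j) :
    f c (x i) (x j) • (t i * t j) = (g c (x i) (x j) + -1) • (t j * t i) := by
  rw [← sub_eq_add_neg, f_eq_g_mul_h hc, mul_smul, ht i j hne, smul_smul,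
    g_mul_h_swap hc (hx.ne hne)]

theorem OddExchanges.selfExchanges_mul {t : ι → A} (ht : OddExchanges c x t) (hc : c ≠ 0)
    (hx : Function.Injective x) (s : Finset ι) :
    SelfExchanges c x (-1) (fun i j => h c (x i) (x j)) t s where
  weightCommute i _ j _ hne := ht i j hne
  f_smul_mul _ _ hne := ht.f_smul_mul hc hx hne
  weight_mul_f i _ j _ hne := by
    rw [← sub_eq_add_neg, ← g_mul_h_swap hc (hx.ne hne.symm), f_eq_g_mul_h hc]
    ring

theorem OddExchanges.selfExchanges_div {t : ι → A} (ht : OddExchanges c x t) (hc : c ≠ 0)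
    (hx : Function.Injective x) {s : Finset ι} (hs : ∀ i ∈ s, ∀ j ∈ s, h c (x i) (x j) ≠ 0) :
    SelfExchanges c x (-1) (fun i j => (h c (x j) (x i))⁻¹) t s where
  weightCommute i hi j hj hne := ht.inv_h_smul_mul hne (hs i hi j hj) (hs j hj i hi)
  f_smul_mul _ _ hne := ht.f_smul_mul hc hx hne
  weight_mul_f i hi j hj hne := by
    have hij := hs i hi j hj
    have hji := hs j hj i hi
    rw [← sub_eq_add_neg, ← g_mul_h_swap hc (hx.ne hne.symm), f_eq_g_mul_h hc]
    field_simp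

variable [LinearOrder ι]

/-- The symmetric product of the `t i`, `i ∈ s`: the increasing product times the factors
`h(x_m, x_l)` with `m < l`. -/
def mulH (c : ℂ) (x : ι → ℂ) (t : ι → A) (s : Finset ι) : A :=
  wprod (fun i j => h c (x i) (x j)) t s

/-- The symmetric product of the `t i`, `i ∈ s`: the increasing product divided by the factors
`h(x_l, x_m)` with `m < l`, as in `𝕋_{j3}(x̄)`. -/
def divH (c : ℂ) (x : ι → ℂ) (t : ι → A) (s : Finset ι) : A :=
  wprod (fun i j => (h c (x j) (x i))⁻¹) t s

variable {t : ι → A} {s : Finset ι} {i : ι}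

theorem mulH_insert (ht : OddExchanges c x t) (hi : i ∉ s) :
    mulH c x t (insert i s) = (∏ j ∈ s, h c (x i) (x j)) • (t i * mulH c x t s) :=
  wprod_insert_left hi fun j _ k _ hjk => ht j k hjk

theorem mul_divH (ht : OddExchanges c x t) (hi : i ∉ s)
    (hs : ∀ j ∈ insert i s, ∀ k ∈ insert i s, h c (x j) (x k) ≠ 0) :
    t i * divH c x t s = (∏ j ∈ s, h c (x j) (x i)) • divH c x t (insert i s) := by
  rw [divH, divH, wprod_insert_left (w := fun i j => (h c (x j) (x i))⁻¹) hi fun j hj k hk hjk =>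
    ht.inv_h_smul_mul hjk (hs j hj k hk) (hs k hk j hj), prod_inv_distrib, smul_inv_smul₀]
  exact prod_ne_zero_iff.mpr fun j hj => hs j (mem_insert_of_mem hj) i (mem_insert_self _ _)

theorem wprod_one_insert_left (ht : ∀ i j, t i * t j = t j * t i) (hi : i ∉ s) :
    wprod 1 t (insert i s) = t i * wprod 1 t s := by
  simp only [wprod_insert_left hi (weightCommute_one ht _), Pi.one_apply, prod_const_one, one_smul]

theorem wprod_one_insert_right (ht : ∀ i j, t i * t j = t j * t i) (hi : i ∉ s) :
    wprod 1 t (insert i s) = wprod 1 t s * t i := by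
  simp only [wprod_insert_right hi (weightCommute_one ht _), Pi.one_apply, prod_const_one, one_smul]

end NormalizedProducts

/-- The commutation relations among `a i = T₁₂(x i)`, `d i = T₂₂(x i)`, `s i = T₂₃(x i)` and
`t i = T₁₃(x i)`; they are all that the identity `X = Y` depends on. -/
structure IsExchangeFamily {ι A : Type*} [Ring A] [Algebra ℂ A] (c : ℂ) (x : ι → ℂ)
    (a d s t : ι → A) : Prop where
  aa : ∀ i j, a i * a j = a j * a i
  dd : ∀ i j, d i * d j = d j * d i
  ss : OddExchanges c x s
  tt : OddExchanges c x t
  at_ : Exchanges c x a t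
  ds : Exchanges c x d s
  da : ∀ i j, i ≠ j →
    d i * a j = f c (x i) (x j) • (a j * d i) - g c (x i) (x j) • (a i * d j)
  as : ∀ i j, i ≠ j → a i * s j - s j * a i = g c (x j) (x i) • (t j * d i - t i * d j)
  st : ∀ i j, i ≠ j →
    s i * t j = -(f c (x j) (x i) • (t j * s i)) - g c (x i) (x j) • (t i * s j)

section Raising

variable {ι A : Type*} [DecidableEq ι] [Ring A] [Algebra ℂ A]

/-- Inserting `o` into the set `U` of parameters of `X`, by acting on the left of the family
`B V = X(x̄_U, x̄_V)`. -/
def raiseLeft (c : ℂ) (x : ι → ℂ) (a d t : ι → A) (o : ι) (U : Finset ι) (B : Finset ι → A)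
    (V : Finset ι) : A :=
  a o * B V + ∑ j ∈ V, recCoeff c x o U V j • (t o * B (V.erase j) * d j)

/-- Inserting `o` into the set `U` of parameters of `Y`, by moving `a o` in from the right of the
family `B V = Y(x̄_U, x̄_V)`. -/
def raiseRight (c : ℂ) (x : ι → ℂ) (a d t : ι → A) (o : ι) (U : Finset ι) (B : Finset ι → A)
    (V : Finset ι) : A :=
  B V * a o + ∑ j ∈ V, recCoeff c x o U V j • (t j * B (V.erase j) * d o)

variable {c : ℂ} {x : ι → ℂ} {a d t : ι → A} {o : ι} {U V : Finset ι} {B B' : Finset ι → A}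

theorem raiseLeft_congr (hB : ∀ V' ⊆ V, B V' = B' V') :
    raiseLeft c x a d t o U B V = raiseLeft c x a d t o U B' V := by
  rw [raiseLeft, raiseLeft, hB V subset_rfl]
  exact congrArg _ (sum_congr rfl fun j _ => by rw [hB _ (erase_subset j V)])

theorem raiseRight_congr (hB : ∀ V' ⊆ V, B V' = B' V') :
    raiseRight c x a d t o U B V = raiseRight c x a d t o U B' V := by
  rw [raiseRight, raiseRight, hB V subset_rfl]
  exact congrArg _ (sum_congr rfl fun j _ => by rw [hB _ (erase_subset j V)])

end Raising

section SumX

variable {ι A : Type*} [LinearOrder ι] [Ring A] [Algebra ℂ A]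

/-- The part `f(x̄_α, x̄_{U∖α}) T₁₃(x̄_α) T₁₂(x̄_{U∖α})` of a summand of `X`, with the
factor `h(x̄_α, x̄_α)` absorbed into the product of the `T₁₃`. -/
def xTerm (c : ℂ) (x : ι → ℂ) (a t : ι → A) (U α : Finset ι) : A :=
  prod₂ (f c) x α x (U \ α) • (mulH c x t α * wprod 1 a (U \ α))

/-- The sum over the partitions of `x̄_U` in `X`, for a fixed subset `β` of the other set. -/
def xSum (c : ℂ) (x : ι → ℂ) (a t : ι → A) (U β : Finset ι) : A :=
  ∑ α ∈ U.powerset, gOn c x x β α • xTerm c x a t U α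

/-- The part `g(x̄_{V∖β}, x̄_β) 𝕋₂₃(x̄_{V∖β}) T₂₂(x̄_β)` of a summand of `X`. -/
def xTail (c : ℂ) (x : ι → ℂ) (d s : ι → A) (V β : Finset ι) : A :=
  prod₂ (g c) x (V \ β) x β • (divH c x s (V \ β) * wprod 1 d β)

/-- The polynomial `X(x̄_U, x̄_V)` of an exchange family. -/
def sumX (c : ℂ) (x : ι → ℂ) (a d s t : ι → A) (U V : Finset ι) : A :=
  ∑ β ∈ V.powerset, xSum c x a t U β * xTail c x d s V β

variable {c : ℂ} {x : ι → ℂ} {a d s t : ι → A} {U V α β : Finset ι} {o j : ι}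

theorem xTerm_insert (hx : Function.Injective x) (haa : ∀ i j, a i * a j = a j * a i)
    (hat : Exchanges c x a t) (htt : OddExchanges c x t) (hc : c ≠ 0) (hoU : o ∉ U) (hα : α ⊆ U) :
    xTerm c x a t (insert o U) α = a o * xTerm c x a t U α
      + ∑ i ∈ α, (g c (x i) (x o) * (∏ k ∈ (U \ α.erase i).erase i, f c (x i) (x k)) *
          ∏ k ∈ α.erase i, h c (x i) (x k)) • (t o * xTerm c x a t U (α.erase i)) := by
  have hoα : o ∉ α := fun ho => hoU (hα ho)
  have hoUα : o ∉ U \ α := fun ho => hoU (mem_sdiff.mp ho).1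
  have hterm (i : ι) (hi : i ∈ α) :
      (g c (x i) (x o) * (∏ k ∈ (U \ α.erase i).erase i, f c (x i) (x k)) *
          ∏ k ∈ α.erase i, h c (x i) (x k)) • (t o * xTerm c x a t U (α.erase i))
      = prod₂ (f c) x α x (U \ α) • (exchangeTerm c x (fun i j => h c (x i) (x j)) a t α o i *
          wprod 1 a (U \ α)) := by
    have hiU : i ∉ U \ α := fun h => (mem_sdiff.mp h).2 hi
    rw [xTerm, exchangeTerm, sdiff_erase (hα hi), erase_insert hiU, wprod_one_insert_left haa hiU,
      prod₂_insert_right _ _ _ _ hiU, ← prod₂_erase_left _ _ _ hi, prod_mul_distrib, mulH]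
    simp only [mul_smul_comm, smul_mul_assoc, smul_smul, mul_assoc]
    congr 1
    ring
  have hcross := mul_wprod hx hat (htt.selfExchanges_mul hc hx α) hoα
  rw [sum_congr rfl hterm, ← smul_sum, ← sum_mul, xTerm, xTerm, insert_sdiff_of_notMem _ hoα,
    prod₂_insert_right _ _ _ _ hoUα, wprod_one_insert_left haa hoUα, mulH, mul_smul_comm,
    ← smul_add, ← mul_assoc (a o), hcross, mul_comm (∏ i ∈ α, _), mul_smul]
  simp only [sub_mul, smul_mul_assoc, mul_assoc, sub_add_cancel]

theorem xTerm_insert_insert (htt : OddExchanges c x t) (hoU : o ∉ U) (hα : α ⊆ U) :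
    xTerm c x a t (insert o U) (insert o α)
      = ((∏ k ∈ U \ α, f c (x o) (x k)) * ∏ k ∈ α, h c (x o) (x k)) •
        (t o * xTerm c x a t U α) := by
  have hoα : o ∉ α := fun ho => hoU (hα ho)
  rw [xTerm, xTerm, insert_sdiff_insert, sdiff_insert_of_notMem hoU, prod₂_insert_left _ _ _ hoα,
    mulH_insert htt hoα]
  simp only [mul_smul_comm, smul_mul_assoc, smul_smul, mul_assoc]
  congr 1
  ring

theorem xSum_insert (hx : Function.Injective x) (haa : ∀ i j, a i * a j = a j * a i)
    (hat : Exchanges c x a t) (htt : OddExchanges c x t) (hc : c ≠ 0) (hoU : o ∉ U) (hoβ : o ∉ β)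
    (hUβ : Disjoint U β) :
    xSum c x a t (insert o U) β = a o * xSum c x a t U β
      + ∑ j ∈ β, recCoeff c x o U β j • (t o * xSum c x a t U (β.erase j)) := by
  rw [xSum, sum_powerset_insert_smul hoU (P₁ := fun α => t o * xTerm c x a t U α)
    (ρ := fun α i =>
      g c (x i) (x o) * (∏ k ∈ (U \ α).erase i, f c (x i) (x k)) * ∏ k ∈ α, h c (x i) (x k)) _
    (fun α hα => xTerm_insert hx haa hat htt hc hoU hα)
    (fun α hα => xTerm_insert_insert htt hoU hα), xSum, mul_sum]
  simp only [mul_smul_comm, xSum, mul_sum, smul_sum, smul_smul]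
  rw [sum_comm (s := β)]
  congr 1
  refine sum_congr rfl fun α hα => ?_
  rw [← sum_smul, gOn_insert_mul_add_sum hc hx hoU hoβ hUβ (mem_powerset.mp hα)]

theorem recCoeff_smul_xTail (hdd : ∀ i j, d i * d j = d j * d i) (hβ : β ⊆ V) (hj : j ∈ β) :
    recCoeff c x o U β j • xTail c x d s V β
      = recCoeff c x o U V j • (xTail c x d s (V.erase j) (β.erase j) * d j) := by
  have hprod := prod₂_sdiff_erase (g c) x hβ hj
  have hd : wprod 1 d β = wprod 1 d (β.erase j) * d j := by
    rw [← wprod_one_insert_right hdd (notMem_erase j β), insert_erase hj]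
  rw [erase_sdiff_erase_of_mem V hj] at hprod
  rw [xTail, xTail, erase_sdiff_erase_of_mem V hj, hd]
  simp only [smul_mul_assoc, smul_smul, mul_assoc, recCoeff, hprod]

theorem sumX_insert (hE : IsExchangeFamily c x a d s t) (hc : c ≠ 0) (hx : Function.Injective x)
    (hoU : o ∉ U) (hoV : o ∉ V) (hUV : Disjoint U V) :
    sumX c x a d s t (insert o U) V = raiseLeft c x a d t o U (sumX c x a d s t U) V := by
  have hβ (β : Finset ι) (hβ : β ∈ V.powerset) :
      xSum c x a t (insert o U) β * xTail c x d s V β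
        = a o * (xSum c x a t U β * xTail c x d s V β) + ∑ j ∈ β, recCoeff c x o U V j •
          (t o * (xSum c x a t U (β.erase j) * xTail c x d s (V.erase j) (β.erase j)) * d j) := by
    rw [mem_powerset] at hβ
    rw [xSum_insert hx hE.aa hE.at_ hE.tt hc hoU (fun ho => hoV (hβ ho)) (hUV.mono_right hβ),
      add_mul, mul_assoc, sum_mul]
    congr 1
    refine sum_congr rfl fun j hj => ?_
    rw [smul_mul_assoc, ← mul_smul_comm, recCoeff_smul_xTail hE.dd hβ hj]
    simp only [mul_smul_comm, mul_assoc]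
  rw [sumX, sum_congr rfl hβ, sum_add_distrib, ← mul_sum, sum_powerset_sum_mem V fun β j =>
    recCoeff c x o U V j •
      (t o * (xSum c x a t U β * xTail c x d s (V.erase j) β) * d j)]
  simp only [raiseLeft, sumX, mul_sum, sum_mul, smul_sum]

end SumX

section SumY

variable {ι A : Type*} [LinearOrder ι] [Ring A] [Algebra ℂ A]

/-- The part `f(x̄_α, x̄_{U∖α}) T₁₂(x̄_{U∖α}) T₂₂(x̄_α)` of a summand of `Y`. -/
def yTerm (c : ℂ) (x : ι → ℂ) (a d : ι → A) (U α : Finset ι) : A :=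
  prod₂ (f c) x α x (U \ α) • (wprod 1 a (U \ α) * wprod 1 d α)

/-- The sum over the partitions of `x̄_U` in `Y`, for a fixed subset `β` of the other set. -/
def ySum (c : ℂ) (x : ι → ℂ) (a d : ι → A) (U β : Finset ι) : A :=
  ∑ α ∈ U.powerset, dwpfOn c x x β α • yTerm c x a d U α

/-- The part `g(x̄_{V∖β}, x̄_β) 𝕋₁₃(x̄_β) 𝕋₂₃(x̄_{V∖β})` of a summand of `Y`. -/
def yHead (c : ℂ) (x : ι → ℂ) (s t : ι → A) (V β : Finset ι) : A :=
  prod₂ (g c) x (V \ β) x β • (divH c x t β * divH c x s (V \ β))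

/-- The polynomial `Y(x̄_U, x̄_V)` of an exchange family. -/
def sumY (c : ℂ) (x : ι → ℂ) (a d s t : ι → A) (U V : Finset ι) : A :=
  ∑ β ∈ V.powerset, yHead c x s t V β * ySum c x a d U β

variable {c : ℂ} {x : ι → ℂ} {a d s t : ι → A} {U V α β : Finset ι} {o j : ι}

theorem yTerm_insert (hx : Function.Injective x) (haa : ∀ i j, a i * a j = a j * a i)
    (hdd : ∀ i j, d i * d j = d j * d i) (hda : ∀ i j, i ≠ j →
      d i * a j = f c (x i) (x j) • (a j * d i) - g c (x i) (x j) • (a i * d j))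
    (hoU : o ∉ U) (hα : α ⊆ U) :
    yTerm c x a d (insert o U) α = yTerm c x a d U α * a o
      + ∑ i ∈ α, (g c (x i) (x o) * ∏ k ∈ (U \ α.erase i).erase i, f c (x i) (x k)) •
          (yTerm c x a d U (α.erase i) * d o) := by
  have hoα : o ∉ α := fun ho => hoU (hα ho)
  have hoUα : o ∉ U \ α := fun ho => hoU (mem_sdiff.mp ho).1
  have hterm (i : ι) (hi : i ∈ α) :
      (g c (x i) (x o) * ∏ k ∈ (U \ α.erase i).erase i, f c (x i) (x k)) •
          (yTerm c x a d U (α.erase i) * d o)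
      = prod₂ (f c) x α x (U \ α) • (wprod 1 a (U \ α) *
          ((g c (x i) (x o) * ∏ j ∈ α.erase i, f c (x j) (x i)) •
            (a i * wprod 1 d (α.erase i) * d o))) := by
    have hiU : i ∉ U \ α := fun h => (mem_sdiff.mp h).2 hi
    rw [yTerm, sdiff_erase (hα hi), erase_insert hiU, wprod_one_insert_right haa hiU,
      prod₂_insert_right _ _ _ _ hiU, ← prod₂_erase_left _ _ _ hi]
    simp only [mul_smul_comm, smul_mul_assoc, smul_smul, mul_assoc]
    congr 1
    ring
  have hcross := wprod_one_mul hx hda hdd hoα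
  rw [sum_congr rfl hterm, ← smul_sum, ← mul_sum, yTerm, yTerm, insert_sdiff_of_notMem _ hoα,
    prod₂_insert_right _ _ _ _ hoUα, wprod_one_insert_right haa hoUα, smul_mul_assoc, ← smul_add,
    mul_assoc, mul_assoc, hcross, mul_comm (∏ i ∈ α, _), mul_smul]
  simp only [mul_sub, mul_smul_comm, sub_add_cancel]

theorem yTerm_insert_insert (hdd : ∀ i j, d i * d j = d j * d i) (hoU : o ∉ U) (hα : α ⊆ U) :
    yTerm c x a d (insert o U) (insert o α)
      = (∏ k ∈ U \ α, f c (x o) (x k)) • (yTerm c x a d U α * d o) := by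
  have hoα : o ∉ α := fun ho => hoU (hα ho)
  rw [yTerm, yTerm, insert_sdiff_insert, sdiff_insert_of_notMem hoU, prod₂_insert_left _ _ _ hoα,
    wprod_one_insert_right hdd hoα]
  simp only [smul_mul_assoc, smul_smul, mul_assoc]

theorem ySum_insert (hc : c ≠ 0) (hx : Function.Injective x)
    (haa : ∀ i j, a i * a j = a j * a i) (hdd : ∀ i j, d i * d j = d j * d i)
    (hda : ∀ i j, i ≠ j →
      d i * a j = f c (x i) (x j) • (a j * d i) - g c (x i) (x j) • (a i * d j))
    (hoU : o ∉ U) (hoβ : o ∉ β) (hUβ : Disjoint U β)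
    (hh : ∀ j ∈ β, ∀ k ∈ insert o U, h c (x j) (x k) ≠ 0) :
    ySum c x a d (insert o U) β = ySum c x a d U β * a o
      + ∑ j ∈ β, (g c (x j) (x o) * (∏ k ∈ U, f c (x j) (x k)) *
          ∏ k ∈ β.erase j, f c (x k) (x j)) • (ySum c x a d U (β.erase j) * d o) := by
  rw [ySum, sum_powerset_insert_smul hoU (P₁ := fun α => yTerm c x a d U α * d o)
    (ρ := fun α i => g c (x i) (x o) * ∏ k ∈ (U \ α).erase i, f c (x i) (x k)) _
    (fun α hα => yTerm_insert hx haa hdd hda hoU hα)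
    (fun α hα => yTerm_insert_insert hdd hoU hα), ySum, sum_mul]
  simp only [smul_mul_assoc, ySum, sum_mul, smul_sum, smul_smul]
  rw [sum_comm (s := β)]
  congr 1
  refine sum_congr rfl fun α hα => ?_
  rw [← sum_smul, dwpfOn_insert_mul_add_sum hc hx hoU hoβ hUβ (mem_powerset.mp hα) hh]

theorem prod_f_smul_yHead (hc : c ≠ 0) (htt : OddExchanges c x t)
    (hV : ∀ j ∈ V, ∀ k ∈ V, h c (x j) (x k) ≠ 0) (hβ : β ⊆ V) (hj : j ∈ β) :
    (∏ k ∈ β.erase j, f c (x k) (x j)) • yHead c x s t V β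
      = (∏ k ∈ V.erase j, g c (x k) (x j)) •
        (t j * yHead c x s t (V.erase j) (β.erase j)) := by
  have hprod := prod₂_sdiff_erase (g c) x hβ hj
  have ht := mul_divH htt (notMem_erase j β)
    (by rw [insert_erase hj]; exact fun k hk l hl => hV k (hβ hk) l (hβ hl))
  rw [erase_sdiff_erase_of_mem V hj] at hprod
  rw [yHead, yHead, erase_sdiff_erase_of_mem V hj, mul_smul_comm, ← mul_assoc, ht,
    insert_erase hj, smul_mul_assoc, smul_smul, smul_smul, smul_smul, hprod]
  simp only [f_eq_g_mul_h hc _ (x j), prod_mul_distrib]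
  congr 1
  ring

theorem sumY_insert (hE : IsExchangeFamily c x a d s t) (hc : c ≠ 0) (hx : Function.Injective x)
    (hoU : o ∉ U) (hoV : o ∉ V) (hUV : Disjoint U V)
    (hh : ∀ j ∈ V, ∀ k ∈ insert o U ∪ V, h c (x j) (x k) ≠ 0) :
    sumY c x a d s t (insert o U) V = raiseRight c x a d t o U (sumY c x a d s t U) V := by
  have hVV (j : ι) (hj : j ∈ V) (k : ι) (hk : k ∈ V) : h c (x j) (x k) ≠ 0 :=
    hh j hj k (mem_union_right _ hk)
  have hβ (β : Finset ι) (hβ : β ∈ V.powerset) :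
      yHead c x s t V β * ySum c x a d (insert o U) β
        = yHead c x s t V β * ySum c x a d U β * a o + ∑ j ∈ β, recCoeff c x o U V j •
          (t j * (yHead c x s t (V.erase j) (β.erase j) * ySum c x a d U (β.erase j)) * d o) := by
    rw [mem_powerset] at hβ
    rw [ySum_insert hc hx hE.aa hE.dd hE.da hoU (fun ho => hoV (hβ ho)) (hUV.mono_right hβ)
      fun j hj k hk => hh j (hβ hj) k (mem_union_left _ hk), mul_add, mul_assoc, mul_sum]
    congr 1
    refine sum_congr rfl fun j hj => ?_
    rw [mul_smul_comm, mul_smul, ← smul_mul_assoc, prod_f_smul_yHead hc hE.tt hVV hβ hj, recCoeff]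
    simp only [smul_mul_assoc, smul_smul, mul_assoc]
  rw [sumY, sum_congr rfl hβ, sum_add_distrib, ← sum_mul, sum_powerset_sum_mem V fun β j =>
    recCoeff c x o U V j •
      (t j * (yHead c x s t (V.erase j) β * ySum c x a d U β) * d o)]
  simp only [raiseRight, sumY, mul_sum, sum_mul, smul_sum]

theorem sumX_empty_left (V : Finset ι) : sumX c x a d s t ∅ V = divH c x s V := by
  rw [sumX, sum_eq_single_of_mem ∅ (empty_mem_powerset V)]
  · simp [xSum, xTerm, xTail, gOn, prod₂, mulH]
  · intro β _ hβ
    simp [xSum, gOn, hβ]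

theorem sumY_empty_left (V : Finset ι) : sumY c x a d s t ∅ V = divH c x s V := by
  rw [sumY, sum_eq_single_of_mem ∅ (empty_mem_powerset V)]
  · simp [ySum, yTerm, yHead, dwpfOn_eq c x x card_empty card_empty, dwpf, prod₂, divH]
  · intro β _ hβ
    simp [ySum, dwpfOn_of_card_ne c x x (show #β ≠ #(∅ : Finset ι) by simpa using hβ)]

end SumY

section CrossRelation

variable {ι A : Type*} [LinearOrder ι] [Ring A] [Algebra ℂ A] {c : ℂ} {x : ι → ℂ}
  {a d s t : ι → A} {W : Finset ι} {o p j : ι}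

theorem mul_divH_erase (hs : OddExchanges c x s) (hj : j ∈ W)
    (hW : ∀ j ∈ W, ∀ k ∈ W, h c (x j) (x k) ≠ 0) :
    s j * divH c x s (W.erase j) = (∏ k ∈ W.erase j, h c (x k) (x j)) • divH c x s W := by
  rw [mul_divH hs (notMem_erase j W) (by rwa [insert_erase hj]), insert_erase hj]

/-- The coefficient of `d o` in the commutator of `a o` with `divH c x s V`. -/
def wantedSum (c : ℂ) (x : ι → ℂ) (s t : ι → A) (o : ι) (V : Finset ι) : A :=
  ∑ j ∈ V, recCoeff c x o ∅ V j • (t j * divH c x s (V.erase j))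

/-- The coefficient of `s o` in the unwanted terms that arise when `d o` is carried through
`divH c x s V`. -/
def unwantedSum (c : ℂ) (x : ι → ℂ) (d s : ι → A) (o : ι) (V : Finset ι) : A :=
  ∑ j ∈ V, recCoeff c x o ∅ V j • (divH c x s (V.erase j) * d j)

theorem mul_divH_eq_sub_unwantedSum (hc : c ≠ 0) (hx : Function.Injective x)
    (hds : Exchanges c x d s) (hss : OddExchanges c x s) (ho : o ∉ W)
    (hW : ∀ j ∈ W, ∀ k ∈ W, h c (x j) (x k) ≠ 0) :
    d o * divH c x s W = (∏ i ∈ W, f c (x i) (x o)) • (divH c x s W * d o)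
      - s o * unwantedSum c x d s o W := by
  rw [divH, mul_wprod hx hds (hss.selfExchanges_div hc hx hW) ho, unwantedSum, mul_sum]
  congr 1
  refine sum_congr rfl fun i hi => ?_
  have hweight : ∏ j ∈ W.erase i, (h c (x j) (x i))⁻¹ * f c (x j) (x i)
      = ∏ j ∈ W.erase i, g c (x j) (x i) := prod_congr rfl fun j hj => by
    rw [f_eq_g_mul_h hc, mul_comm, mul_inv_cancel_right₀ (hW j (mem_of_mem_erase hj) i hi)]
  rw [exchangeTerm, hweight, recCoeff, prod_empty, mul_one, mul_smul_comm, mul_assoc, divH]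

theorem prod_h_mul_recCoeff_insert_self (hc : c ≠ 0) (hp : p ∉ W) :
    (∏ k ∈ W, h c (x k) (x p)) * recCoeff c x o ∅ (insert p W) p
      = g c (x p) (x o) * ∏ k ∈ W, f c (x k) (x p) := by
  simp only [recCoeff, erase_insert hp, prod_empty, f_eq_g_mul_h hc, prod_mul_distrib]
  ring

theorem prod_h_smul_recCoeff_smul_divH (hc : c ≠ 0) (hs : OddExchanges c x s) (hp : p ∉ W)
    (hj : j ∈ W) (hW : ∀ j ∈ insert p W, ∀ k ∈ insert p W, h c (x j) (x k) ≠ 0) :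
    (∏ k ∈ W, h c (x k) (x p)) • recCoeff c x o ∅ (insert p W) j •
        divH c x s ((insert p W).erase j)
      = - (f c (x j) (x p) * recCoeff c x o ∅ W j) • (s p * divH c x s (W.erase j)) := by
  have hpj : p ∉ W.erase j := fun h => hp (mem_of_mem_erase h)
  have hsub : insert p (W.erase j) ⊆ insert p W := insert_subset_insert _ (erase_subset _ _)
  rw [recCoeff, recCoeff, erase_insert_of_ne (ne_of_mem_of_not_mem hj hp).symm, prod_insert hpj,
    mul_divH hs hpj fun k hk l hl => hW k (hsub hk) l (hsub hl), ← mul_prod_erase W _ hj,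
    f_eq_g_mul_h hc, g_swap (x p) (x j)]
  simp only [smul_smul]
  congr 1
  ring

theorem prod_h_smul_wantedSum_insert (hc : c ≠ 0) (hx : Function.Injective x)
    (hss : OddExchanges c x s) (hst : ∀ i j, i ≠ j →
      s i * t j = -(f c (x j) (x i) • (t j * s i)) - g c (x i) (x j) • (t i * s j))
    (hop : o ≠ p) (hoW : o ∉ W) (hp : p ∉ W)
    (hW : ∀ j ∈ insert p W, ∀ k ∈ insert p W, h c (x j) (x k) ≠ 0) :
    (∏ k ∈ W, h c (x k) (x p)) • wantedSum c x s t o (insert p W)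
      = s p * wantedSum c x s t o W
        + (g c (x p) (x o) * ∏ k ∈ W, f c (x k) (x o)) • (t p * divH c x s W) := by
  have hterm (j : ι) (hj : j ∈ W) :
      (∏ k ∈ W, h c (x k) (x p)) • recCoeff c x o ∅ (insert p W) j •
          (t j * divH c x s ((insert p W).erase j))
        = s p * recCoeff c x o ∅ W j • (t j * divH c x s (W.erase j))
          + (g c (x j) (x o) * g c (x p) (x j) * ∏ k ∈ W.erase j, f c (x k) (x j)) •
            (t p * divH c x s W) := by
    have hpush := mul_divH_erase hss hj fun k hk l hl =>
      hW k (mem_insert_of_mem hk) l (mem_insert_of_mem hl)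
    rw [← mul_smul_comm, ← mul_smul_comm, prod_h_smul_recCoeff_smul_divH hc hss hp hj hW,
      mul_smul_comm (recCoeff c x o ∅ W j), ← mul_assoc (s p),
      hst p j (ne_of_mem_of_not_mem hj hp).symm]
    simp only [sub_mul, neg_mul, smul_mul_assoc, mul_assoc, hpush, recCoeff,
      f_eq_g_mul_h hc _ (x j), prod_mul_distrib, mul_smul_comm, smul_sub, smul_neg, smul_smul,
      prod_empty, mul_one]
    module
  rw [wantedSum, smul_sum, sum_insert hp, sum_congr rfl hterm, sum_add_distrib, ← mul_sum,
    ← sum_smul, smul_smul, prod_h_mul_recCoeff_insert_self hc hp, erase_insert hp,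
    ← sum_residues_pair_swap hc hx hop hoW hp, wantedSum]
  module

theorem prod_h_smul_unwantedSum_insert (hc : c ≠ 0) (hx : Function.Injective x)
    (hss : OddExchanges c x s) (hop : o ≠ p) (hoW : o ∉ W) (hp : p ∉ W)
    (hW : ∀ j ∈ insert p W, ∀ k ∈ insert p W, h c (x j) (x k) ≠ 0) :
    (∏ k ∈ W, h c (x k) (x p)) • unwantedSum c x d s o (insert p W)
      = (g c (x p) (x o) * ∏ k ∈ W, f c (x k) (x p)) • (divH c x s W * d p)
        - f c (x o) (x p) • (s p * unwantedSum c x d s o W)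
        - g c (x p) (x o) • (s p * unwantedSum c x d s p W) := by
  have hterm (j : ι) (hj : j ∈ W) :
      (∏ k ∈ W, h c (x k) (x p)) • recCoeff c x o ∅ (insert p W) j •
          (divH c x s ((insert p W).erase j) * d j)
        = - (f c (x o) (x p) • (s p * recCoeff c x o ∅ W j • (divH c x s (W.erase j) * d j))
          + g c (x p) (x o) • (s p * recCoeff c x p ∅ W j • (divH c x s (W.erase j) * d j))) := by
    have hjp : j ≠ p := ne_of_mem_of_not_mem hj hp
    have hjo : j ≠ o := ne_of_mem_of_not_mem hj hoW
    have hcoeff : f c (x j) (x p) * g c (x j) (x o)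
        = f c (x o) (x p) * g c (x j) (x o) + g c (x p) (x o) * g c (x j) (x p) := by
      rw [f_eq_one_add_g (hx.ne hop), f_eq_one_add_g (hx.ne hjp), g_swap (x p) (x o)]
      linear_combination - g_mul_g (c := c) (hx.ne hjp) (hx.ne hop.symm) (hx.ne hjo)
    rw [← smul_mul_assoc, ← smul_mul_assoc, prod_h_smul_recCoeff_smul_divH hc hss hp hj hW]
    simp only [mul_smul_comm, smul_mul_assoc, smul_smul, ← neg_smul, ← add_smul, mul_assoc,
      recCoeff, prod_empty, one_mul]
    congr 1
    linear_combination - (∏ k ∈ W.erase j, g c (x k) (x j)) * hcoeff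
  rw [unwantedSum, smul_sum, sum_insert hp, sum_congr rfl hterm, sum_neg_distrib, sum_add_distrib,
    ← smul_sum, ← smul_sum, ← mul_sum, ← mul_sum, smul_smul,
    prod_h_mul_recCoeff_insert_self hc hp, erase_insert hp, unwantedSum, unwantedSum]
  abel

theorem mul_divH_sub_divH_mul (hE : IsExchangeFamily c x a d s t) (hc : c ≠ 0)
    (hx : Function.Injective x) (ho : o ∉ W) (hW : ∀ j ∈ W, ∀ k ∈ W, h c (x j) (x k) ≠ 0) :
    a o * divH c x s W - divH c x s W * a o
      = wantedSum c x s t o W * d o - t o * unwantedSum c x d s o W := by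
  induction W using Finset.induction_on with
  | empty => simp [divH, wantedSum, unwantedSum]
  | insert p W hp ih =>
    obtain ⟨hop, hoW⟩ : o ≠ p ∧ o ∉ W := by simpa using ho
    have hWW (j : ι) (hj : j ∈ W) (k : ι) (hk : k ∈ W) : h c (x j) (x k) ≠ 0 :=
      hW j (mem_insert_of_mem hj) k (mem_insert_of_mem hk)
    have hH : ∏ k ∈ W, h c (x k) (x p) ≠ 0 := prod_ne_zero_iff.mpr fun k hk =>
      hW k (mem_insert_of_mem hk) p (mem_insert_self _ _)
    refine smul_right_injective A hH ?_
    dsimp only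
    rw [smul_sub, smul_sub, ← mul_smul_comm, ← smul_mul_assoc, ← smul_mul_assoc, ← mul_smul_comm,
      ← mul_divH hE.ss hp hW, prod_h_smul_wantedSum_insert hc hx hE.ss hE.st hop hoW hp hW,
      prod_h_smul_unwantedSum_insert hc hx hE.ss hop hoW hp hW]
    calc a o * (s p * divH c x s W) - s p * divH c x s W * a o
        = s p * (a o * divH c x s W - divH c x s W * a o)
          + g c (x p) (x o) • (t p * (d o * divH c x s W) - t o * (d p * divH c x s W)) := by
          rw [← mul_assoc, ← sub_add_cancel (a o * s p) (s p * a o), hE.as o p hop]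
          simp only [add_mul, sub_mul, mul_sub, smul_mul_assoc, mul_assoc, smul_sub]
          abel
      _ = _ := by
          rw [ih hoW hWW, mul_divH_eq_sub_unwantedSum hc hx hE.ds hE.ss hoW hWW,
            mul_divH_eq_sub_unwantedSum hc hx hE.ds hE.ss hp hWW, mul_sub, ← mul_assoc (s p) (t o),
            hE.st p o hop.symm]
          simp only [add_mul, sub_mul, neg_mul, mul_sub, smul_mul_assoc, mul_smul_comm, mul_assoc,
            smul_sub, smul_smul]
          abel

theorem raiseLeft_divH (hE : IsExchangeFamily c x a d s t) (hc : c ≠ 0)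
    (hx : Function.Injective x) (ho : o ∉ W) (hW : ∀ j ∈ W, ∀ k ∈ W, h c (x j) (x k) ≠ 0) :
    raiseLeft c x a d t o ∅ (divH c x s) W = raiseRight c x a d t o ∅ (divH c x s) W := by
  have hcross := mul_divH_sub_divH_mul hE hc hx ho hW
  simp only [wantedSum, unwantedSum, sum_mul, mul_sum, smul_mul_assoc, mul_smul_comm,
    ← mul_assoc] at hcross
  rw [raiseLeft, raiseRight, sub_eq_sub_iff_add_eq_add.mp hcross, add_comm]

end CrossRelation

section RaisingCommute

variable {ι A : Type*} [DecidableEq ι] [Ring A] [Algebra ℂ A] {c : ℂ} {x : ι → ℂ}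
  {a d s t : ι → A} {U V : Finset ι} {B : Finset ι → A} {o q j k : ι}

theorem recCoeff_insert (hq : q ∉ U) :
    recCoeff c x o (insert q U) V j = recCoeff c x o U V j * f c (x j) (x q) := by
  rw [recCoeff, recCoeff, prod_insert hq]
  ring

theorem recCoeff_cancel (hx : Function.Injective x) (hoV : o ∉ V) (hqV : q ∉ V) (hj : j ∈ V)
    (hk : k ∈ V) (hjk : j ≠ k) :
    recCoeff c x o U V j * f c (x j) (x q) * recCoeff c x q U (V.erase j) k
      + recCoeff c x o U V k * g c (x k) (x q) * recCoeff c x k U (V.erase k) j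
      = recCoeff c x q U V k * (g c (x k) (x o) - 1) * recCoeff c x o U (V.erase k) j
        + recCoeff c x o U V j * g c (x j) (x q) * recCoeff c x j U (V.erase j) k := by
  have hko : k ≠ o := ne_of_mem_of_not_mem hk hoV
  have hjo : j ≠ o := ne_of_mem_of_not_mem hj hoV
  have hkq : k ≠ q := ne_of_mem_of_not_mem hk hqV
  have hjq : j ≠ q := ne_of_mem_of_not_mem hj hqV
  simp only [recCoeff]
  rw [← mul_prod_erase (V.erase j) (fun l => g c (x l) (x j)) (mem_erase.mpr ⟨hjk.symm, hk⟩),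
    ← mul_prod_erase (V.erase k) (fun l => g c (x l) (x k)) (mem_erase.mpr ⟨hjk, hj⟩),
    erase_right_comm (a := k), f_eq_one_add_g (hx.ne hjq), g_swap (x k) (x j)]
  linear_combination (∏ l ∈ U, f c (x j) (x l)) * (∏ l ∈ U, f c (x k) (x l)) *
    (∏ l ∈ (V.erase j).erase k, g c (x l) (x j)) * (∏ l ∈ (V.erase j).erase k, g c (x l) (x k)) *
    g c (x k) (x j) * (g c (x j) (x o) * -g_mul_g (c := c) (hx.ne hjk.symm) (hx.ne hjq) (hx.ne hkq)
      + -g c (x k) (x q) * g_mul_g (c := c) (hx.ne hjk.symm) (hx.ne hjo) (hx.ne hko))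

/-- The operator produced by inserting `o` on the left and `q` on the right when both insertions
exchange an element of `V`: `j` and `k` leave `V` for the factors `d` and `t` respectively. -/
def doubleExchange (d t : ι → A) (B : Finset ι → A) (V : Finset ι) (o q j k : ι) : A :=
  t o * t k * B ((V.erase j).erase k) * d j * d q

theorem raiseLeft_raiseRight (hdd : ∀ i j, d i * d j = d j * d i) (hqU : q ∉ U) :
    raiseLeft c x a d t o (insert q U) (raiseRight c x a d t q U B) V = a o * B V * a q
      + ∑ j ∈ V, (recCoeff c x q U V j • (a o * t j * B (V.erase j) * d q)
          + (recCoeff c x o U V j * f c (x j) (x q)) • (t o * B (V.erase j) * a q * d j))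
      + ∑ j ∈ V, ∑ k ∈ V.erase j, (recCoeff c x o U V j * f c (x j) (x q) *
          recCoeff c x q U (V.erase j) k) • doubleExchange d t B V o q j k := by
  simp only [raiseLeft, raiseRight, recCoeff_insert hqU, doubleExchange, mul_add, add_mul,
    sum_add_distrib, mul_sum, sum_mul, smul_add, smul_sum, mul_smul_comm, smul_mul_assoc,
    smul_smul, mul_assoc, hdd q, add_assoc]

theorem raiseRight_raiseLeft (hc : c ≠ 0) (hx : Function.Injective x) (htt : OddExchanges c x t)
    (hoU : o ∉ U) (hoV : o ∉ V) :
    raiseRight c x a d t q (insert o U) (raiseLeft c x a d t o U B) V = a o * B V * a q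
      + ∑ j ∈ V, ((recCoeff c x q U V j * f c (x j) (x o)) • (t j * a o * B (V.erase j) * d q)
          + recCoeff c x o U V j • (t o * B (V.erase j) * d j * a q))
      + ∑ j ∈ V, ∑ k ∈ V.erase j, (recCoeff c x q U V j * (g c (x j) (x o) - 1) *
          recCoeff c x o U (V.erase j) k) • doubleExchange d t B V o q k j := by
  have hexchange (j : ι) (hj : j ∈ V) (r : A) :
      f c (x j) (x o) • (t j * (t o * r)) = (g c (x j) (x o) - 1) • (t o * (t j * r)) := by
    rw [← mul_assoc, ← smul_mul_assoc, htt.f_smul_mul hc hx (ne_of_mem_of_not_mem hj hoV),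
      smul_mul_assoc, mul_assoc, sub_eq_add_neg]
  have hdouble (j : ι) (hj : j ∈ V) (k : ι) :
      (recCoeff c x q U V j * (g c (x j) (x o) - 1) * recCoeff c x o U (V.erase j) k) •
          doubleExchange d t B V o q k j
        = (recCoeff c x q U V j * f c (x j) (x o) * recCoeff c x o U (V.erase j) k) •
          (t j * (t o * (B ((V.erase j).erase k) * (d k * d q)))) := by
    rw [mul_right_comm, mul_smul, mul_right_comm, mul_smul _ (f c _ _), hexchange j hj,
      doubleExchange, erase_right_comm]
    simp only [mul_assoc]
  rw [sum_congr rfl fun j hj => sum_congr rfl fun k _ => hdouble j hj k]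
  simp only [raiseLeft, raiseRight, recCoeff_insert hoU, mul_add, add_mul,
    sum_add_distrib, mul_sum, sum_mul, smul_add, smul_sum, mul_smul_comm, smul_mul_assoc,
    smul_smul, mul_assoc]
  abel

theorem sum_recCoeff_smul_doubleExchange
    (hcomm : raiseLeft c x a d t j U B (V.erase j) = raiseRight c x a d t j U B (V.erase j)) :
    t o * (a j * B (V.erase j)) * d q
        + ∑ k ∈ V.erase j, recCoeff c x j U (V.erase j) k • doubleExchange d t B V o q k j
      = t o * (B (V.erase j) * a j) * d q
        + ∑ k ∈ V.erase j, recCoeff c x j U (V.erase j) k • doubleExchange d t B V o q j k := by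
  have := congrArg (fun z => t o * z * d q) hcomm
  simpa only [raiseLeft, raiseRight, mul_add, add_mul, mul_sum, sum_mul, mul_smul_comm,
    smul_mul_assoc, mul_assoc, doubleExchange, erase_right_comm (a := j)] using this

theorem single_exchange_add_double (hat : Exchanges c x a t)
    (hda : ∀ i j, i ≠ j →
      d i * a j = f c (x i) (x j) • (a j * d i) - g c (x i) (x j) • (a i * d j))
    (hoV : o ∉ V) (hqV : q ∉ V) (hj : j ∈ V)
    (hcomm : raiseLeft c x a d t j U B (V.erase j) = raiseRight c x a d t j U B (V.erase j)) :
    recCoeff c x q U V j • (a o * t j * B (V.erase j) * d q)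
        + (recCoeff c x o U V j * f c (x j) (x q)) • (t o * B (V.erase j) * a q * d j)
        + ∑ k ∈ V.erase j, (recCoeff c x o U V j * g c (x j) (x q) *
            recCoeff c x j U (V.erase j) k) • doubleExchange d t B V o q j k
      = (recCoeff c x q U V j * f c (x j) (x o)) • (t j * a o * B (V.erase j) * d q)
        + recCoeff c x o U V j • (t o * B (V.erase j) * d j * a q)
        + ∑ k ∈ V.erase j, (recCoeff c x o U V j * g c (x j) (x q) *
            recCoeff c x j U (V.erase j) k) • doubleExchange d t B V o q k j := by
  have hcoeff : recCoeff c x q U V j * g c (x j) (x o)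
      = recCoeff c x o U V j * g c (x j) (x q) := by
    rw [recCoeff, recCoeff]
    ring
  have hsum := congrArg ((recCoeff c x o U V j * g c (x j) (x q)) • ·)
    (sum_recCoeff_smul_doubleExchange (d := d) (o := o) (q := q) hcomm)
  simp only [smul_add, smul_sum, smul_smul] at hsum
  rw [hat o j (ne_of_mem_of_not_mem hj hoV).symm, mul_assoc _ (d j),
    hda j q (ne_of_mem_of_not_mem hj hqV)]
  simp only [mul_sub, sub_mul, smul_sub, mul_smul_comm, smul_mul_assoc, smul_smul, hcoeff,
    mul_assoc] at hsum ⊢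
  linear_combination (norm := abel) -hsum

theorem raiseLeft_raiseRight_comm (hE : IsExchangeFamily c x a d s t) (hc : c ≠ 0)
    (hx : Function.Injective x) (hoU : o ∉ U) (hqU : q ∉ U) (hoV : o ∉ V) (hqV : q ∉ V)
    (hcomm : ∀ j ∈ V,
      raiseLeft c x a d t j U B (V.erase j) = raiseRight c x a d t j U B (V.erase j)) :
    raiseLeft c x a d t o (insert q U) (raiseRight c x a d t q U B) V
      = raiseRight c x a d t q (insert o U) (raiseLeft c x a d t o U B) V := by
  have hsingle := sum_congr rfl fun j hj =>
    single_exchange_add_double (o := o) hE.at_ hE.da hoV hqV hj (hcomm j hj)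
  have hswap (F : ι → ι → A) :
      ∑ j ∈ V, ∑ k ∈ V.erase j, F j k = ∑ j ∈ V, ∑ k ∈ V.erase j, F k j :=
    sum_comm' fun j k => by simp only [mem_erase]; tauto
  have hdouble : ∑ j ∈ V, ∑ k ∈ V.erase j, (recCoeff c x o U V j * f c (x j) (x q) *
          recCoeff c x q U (V.erase j) k) • doubleExchange d t B V o q j k
        + ∑ j ∈ V, ∑ k ∈ V.erase j, (recCoeff c x o U V j * g c (x j) (x q) *
          recCoeff c x j U (V.erase j) k) • doubleExchange d t B V o q k j
      = ∑ j ∈ V, ∑ k ∈ V.erase j, (recCoeff c x q U V j * (g c (x j) (x o) - 1) *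
          recCoeff c x o U (V.erase j) k) • doubleExchange d t B V o q k j
        + ∑ j ∈ V, ∑ k ∈ V.erase j, (recCoeff c x o U V j * g c (x j) (x q) *
          recCoeff c x j U (V.erase j) k) • doubleExchange d t B V o q j k := by
    rw [hswap fun j k => _ • doubleExchange d t B V o q k j,
      hswap fun j k => (recCoeff c x q U V j * _ * _) • doubleExchange d t B V o q k j]
    simp only [← sum_add_distrib, ← add_smul]
    refine sum_congr rfl fun j hj => sum_congr rfl fun k hk => ?_
    rw [recCoeff_cancel hx hoV hqV hj (mem_of_mem_erase hk) (ne_of_mem_erase hk).symm]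
  rw [raiseLeft_raiseRight hE.dd hqU, raiseRight_raiseLeft hc hx hE.tt hoU hoV]
  simp only [sum_add_distrib] at hsingle hdouble ⊢
  linear_combination (norm := abel) hsingle + hdouble

end RaisingCommute

section Equality

variable {ι A : Type*} [LinearOrder ι] [Ring A] [Algebra ℂ A] {c : ℂ} {x : ι → ℂ}
  {a d s t : ι → A} {U V : Finset ι} {o q : ι}

theorem raiseLeft_sumX (hE : IsExchangeFamily c x a d s t) (hc : c ≠ 0)
    (hx : Function.Injective x) (hoU : o ∉ U) (hoV : o ∉ V) (hUV : Disjoint U V)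
    (hh : ∀ j ∈ V, ∀ k ∈ insert o U ∪ V, h c (x j) (x k) ≠ 0)
    (hU : ∀ V' ⊆ V, sumX c x a d s t U V' = sumY c x a d s t U V')
    (hoU' : sumX c x a d s t (insert o U) V = sumY c x a d s t (insert o U) V) :
    raiseLeft c x a d t o U (sumX c x a d s t U) V
      = raiseRight c x a d t o U (sumX c x a d s t U) V := by
  rw [← sumX_insert hE hc hx hoU hoV hUV, hoU', sumY_insert hE hc hx hoU hoV hUV hh,
    raiseRight_congr hU]

theorem sumX_insert_insert_eq_sumY (hE : IsExchangeFamily c x a d s t) (hc : c ≠ 0)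
    (hx : Function.Injective x) (hoq : o ≠ q) (hoU : o ∉ U) (hqU : q ∉ U)
    (hUV : Disjoint (insert o (insert q U)) V)
    (hh : ∀ j ∈ V, ∀ k ∈ insert o (insert q U) ∪ V, h c (x j) (x k) ≠ 0)
    (ih : ∀ U' V', #U' ≤ #U + 1 → V' ⊆ V → U' ⊆ insert o (insert q U) ∪ V → Disjoint U' V' →
      sumX c x a d s t U' V' = sumY c x a d s t U' V') :
    sumX c x a d s t (insert o (insert q U)) V = sumY c x a d s t (insert o (insert q U)) V := by
  obtain ⟨hoV, hqUV⟩ := disjoint_insert_left.mp hUV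
  obtain ⟨hqV, hUV'⟩ := disjoint_insert_left.mp hqUV
  have hU : U ⊆ insert o (insert q U) ∪ V := fun i hi => by simp [hi]
  have hinsert {p : ι} {V' : Finset ι} (hp : p ∈ insert o (insert q U) ∪ V) (hV' : V' ⊆ V)
      (hpV' : p ∉ V') : sumX c x a d s t (insert p U) V' = sumY c x a d s t (insert p U) V' :=
    ih _ _ (card_insert_le _ _) hV' (insert_subset hp hU)
      (disjoint_insert_left.mpr ⟨hpV', hUV'.mono_right hV'⟩)
  have hraise {p : ι} {V' : Finset ι} (hp : p ∈ insert o (insert q U) ∪ V) (hpU : p ∉ U)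
      (hV' : V' ⊆ V) (hpV' : p ∉ V') :
      raiseLeft c x a d t p U (sumX c x a d s t U) V'
        = raiseRight c x a d t p U (sumX c x a d s t U) V' :=
    raiseLeft_sumX hE hc hx hpU hpV' (hUV'.mono_right hV')
      (fun j hj k hk => hh j (hV' hj) k (union_subset (insert_subset hp hU)
        (hV'.trans subset_union_right) hk))
      (fun W hW => ih U W (Nat.le_succ _) (hW.trans hV') hU (hUV'.mono_right (hW.trans hV')))
      (hinsert hp hV' hpV')
  have hX {p : ι} {V' : Finset ι} (hpU : p ∉ U) (hpV : p ∉ V) (hV' : V' ⊆ V) :=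
    sumX_insert hE hc hx hpU (fun h => hpV (hV' h)) (hUV'.mono_right hV')
  calc sumX c x a d s t (insert o (insert q U)) V
      = raiseLeft c x a d t o (insert q U) (sumX c x a d s t (insert q U)) V :=
        sumX_insert hE hc hx (by simp [hoq, hoU]) hoV hqUV
    _ = raiseLeft c x a d t o (insert q U) (raiseRight c x a d t q U (sumX c x a d s t U)) V :=
        raiseLeft_congr fun V' hV' => (hX hqU hqV hV').trans
          (hraise (by simp) hqU hV' fun h => hqV (hV' h))
    _ = raiseRight c x a d t q (insert o U) (raiseLeft c x a d t o U (sumX c x a d s t U)) V :=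
        raiseLeft_raiseRight_comm hE hc hx hoU hqU hoV hqV fun j hj =>
          hraise (mem_union_right _ hj) (disjoint_right.mp hUV' hj) (erase_subset j V)
            (notMem_erase j V)
    _ = raiseRight c x a d t q (insert o U) (sumY c x a d s t (insert o U)) V :=
        raiseRight_congr fun V' hV' => (hX hoU hoV hV').symm.trans
          (hinsert (by simp) hV' fun h => hoV (hV' h))
    _ = sumY c x a d s t (insert o (insert q U)) V := by
        rw [insert_comm, sumY_insert hE hc hx (by simp [hoq.symm, hqU]) hqV
          (disjoint_insert_left.mpr ⟨hoV, hUV'⟩) (by rwa [insert_comm])]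

theorem sumX_eq_sumY (hE : IsExchangeFamily c x a d s t) (hc : c ≠ 0) (hx : Function.Injective x)
    (hUV : Disjoint U V) (hh : ∀ j ∈ V, ∀ k ∈ U ∪ V, h c (x j) (x k) ≠ 0) :
    sumX c x a d s t U V = sumY c x a d s t U V := by
  induction hn : #U using Nat.strong_induction_on generalizing U V with
  | _ n ih =>
    rcases U.eq_empty_or_nonempty with rfl | ⟨o, hoU⟩
    · rw [sumX_empty_left, sumY_empty_left]
    obtain ⟨U, hoU', rfl⟩ : ∃ U', o ∉ U' ∧ insert o U' = U :=
      ⟨U.erase o, notMem_erase _ _, insert_erase hoU⟩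
    obtain ⟨hoV, hUV'⟩ := disjoint_insert_left.mp hUV
    rcases U.eq_empty_or_nonempty with rfl | ⟨q, hqU⟩
    · rw [sumX_insert hE hc hx hoU' hoV hUV', sumY_insert hE hc hx hoU' hoV hUV' hh,
        funext sumX_empty_left, funext sumY_empty_left]
      exact raiseLeft_divH hE hc hx hoV fun j hj k hk => hh j hj k (mem_union_right _ hk)
    obtain ⟨U, hqU', rfl⟩ : ∃ U', q ∉ U' ∧ insert q U' = U :=
      ⟨U.erase q, notMem_erase _ _, insert_erase hqU⟩
    rw [card_insert_of_notMem hoU', card_insert_of_notMem hqU'] at hn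
    refine sumX_insert_insert_eq_sumY hE hc hx (fun e => hoU' (by simp [e]))
      (fun h => hoU' (mem_insert_of_mem h)) hqU' hUV hh fun U' V' hcard hV' hU' hUV' => ?_
    exact ih _ (by omega) hUV' (fun j hj k hk => hh j (hV' hj) k
      (union_subset hU' (hV'.trans subset_union_right) hk)) rfl

end Equality

section Relations

variable {A : Type*} [Ring A] [Algebra ℂ A] {c : ℂ} {D : Set ℂ} {T : Fin 3 → Fin 3 → ℂ → A}

theorem IsMonodromy.commute_even (hT : IsMonodromy c D T) {i j : Fin 3}
    (hi : par i = 0) (hj : par j = 0) {u v : ℂ} (hu : u ∈ D) (hv : v ∈ D) :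
    T i j u * T i j v = T i j v * T i j u := by
  rcases eq_or_ne u v with rfl | huv
  · rfl
  have huv' : T i j u * T i j v - T i j v * T i j u
      = g c u v • (T i j v * T i j u - T i j u * T i j v) := by
    simpa [hi, hj] using hT i j i j u hu v hv huv
  have hvu' : T i j v * T i j u - T i j u * T i j v
      = -(g c u v • (T i j u * T i j v - T i j v * T i j u)) := by
    simpa [hi, hj, g_swap u v] using hT i j i j v hv u hu huv.symm
  linear_combination (norm := module) (1 / 2 : ℂ) • (huv' - hvu')

theorem IsMonodromy.h_smul_mul_swap (hT : IsMonodromy c D T) (hc : c ≠ 0) {i : Fin 3}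
    (hi : par i = 0) {u v : ℂ} (hu : u ∈ D) (hv : v ∈ D) (huv : u ≠ v) :
    h c u v • (T i 2 u * T i 2 v) = h c v u • (T i 2 v * T i 2 u) := by
  have hrel : T i 2 u * T i 2 v + T i 2 v * T i 2 u
      = g c u v • (T i 2 v * T i 2 u - T i 2 u * T i 2 v) := by
    simpa [hi, show par 2 = 1 from rfl] using hT i 2 i 2 u hu v hv huv
  apply smul_right_injective A (g_ne_zero hc huv)
  simp only [smul_smul, ← f_eq_g_mul_h hc, g_mul_h_swap hc huv, f_eq_one_add_g huv]
  linear_combination (norm := module) hrel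

theorem IsMonodromy.oddExchanges (hT : IsMonodromy c D T) (hc : c ≠ 0) {i : Fin 3}
    (hi : par i = 0) {ι : Type*} {x : ι → ℂ} (hx : Function.Injective x) (hxD : ∀ k, x k ∈ D) :
    OddExchanges c x (T i 2 ∘ x) :=
  fun k l hkl => hT.h_smul_mul_swap hc hi (hxD k) (hxD l) (hx.ne hkl)

theorem IsMonodromy.isExchangeFamily (hT : IsMonodromy c D T) (hc : c ≠ 0) {ι : Type*} {x : ι → ℂ}
    (hx : Function.Injective x) (hxD : ∀ i, x i ∈ D) :
    IsExchangeFamily c x (T 0 1 ∘ x) (T 1 1 ∘ x) (T 1 2 ∘ x) (T 0 2 ∘ x) where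
  aa i j := hT.commute_even rfl rfl (hxD i) (hxD j)
  dd i j := hT.commute_even rfl rfl (hxD i) (hxD j)
  ss := hT.oddExchanges hc rfl hx hxD
  tt := hT.oddExchanges hc rfl hx hxD
  at_ i j hij := by
    have hrel : T 0 2 (x j) * T 0 1 (x i) - T 0 1 (x i) * T 0 2 (x j)
        = g c (x j) (x i) • (T 0 2 (x i) * T 0 1 (x j) - T 0 2 (x j) * T 0 1 (x i)) := by
      simpa [par] using hT 0 2 0 1 _ (hxD j) _ (hxD i) (hx.ne hij.symm)
    rw [f_eq_one_add_g (hx.ne hij.symm)]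
    linear_combination (norm := (dsimp; module)) -hrel
  da i j hij := by
    have hrel : T 1 1 (x i) * T 0 1 (x j) - T 0 1 (x j) * T 1 1 (x i)
        = g c (x i) (x j) • (T 0 1 (x j) * T 1 1 (x i) - T 0 1 (x i) * T 1 1 (x j)) := by
      simpa [par] using hT 1 1 0 1 _ (hxD i) _ (hxD j) (hx.ne hij)
    rw [f_eq_one_add_g (hx.ne hij)]
    linear_combination (norm := (dsimp; module)) hrel
  ds i j hij := by
    have hrel : T 1 2 (x j) * T 1 1 (x i) - T 1 1 (x i) * T 1 2 (x j)
        = g c (x j) (x i) • (T 1 2 (x i) * T 1 1 (x j) - T 1 2 (x j) * T 1 1 (x i)) := by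
      simpa [par] using hT 1 2 1 1 _ (hxD j) _ (hxD i) (hx.ne hij.symm)
    rw [f_eq_one_add_g (hx.ne hij.symm)]
    linear_combination (norm := (dsimp; module)) -hrel
  as i j hij := by
    have hrel : T 1 2 (x j) * T 0 1 (x i) - T 0 1 (x i) * T 1 2 (x j)
        = g c (x j) (x i) • (T 0 2 (x i) * T 1 1 (x j) - T 0 2 (x j) * T 1 1 (x i)) := by
      simpa [par] using hT 1 2 0 1 _ (hxD j) _ (hxD i) (hx.ne hij.symm)
    linear_combination (norm := (dsimp; module)) -hrel
  st i j hij := by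
    have hrel : T 1 2 (x i) * T 0 2 (x j) + T 0 2 (x j) * T 1 2 (x i)
        = g c (x i) (x j) • (T 0 2 (x j) * T 1 2 (x i) - T 0 2 (x i) * T 1 2 (x j)) := by
      simpa [par] using hT 1 2 0 2 _ (hxD i) _ (hxD j) (hx.ne hij)
    rw [f_eq_one_add_g (hx.ne hij.symm), g_swap (x i) (x j)]
    linear_combination (norm := (dsimp; module)) hrel

end Relations

section Transport

variable {ι κ ι' κ' : Type*}

theorem prod₂_map (φ : ℂ → ℂ → ℂ) (x : ι' → ℂ) (y : κ' → ℂ) (e : ι ↪ ι') (e' : κ ↪ κ')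
    (s : Finset ι) (t : Finset κ) :
    prod₂ φ x (s.map e) y (t.map e') = prod₂ φ (x ∘ e) s (y ∘ e') t := by
  simp only [prod₂, prod_map, Function.comp_apply]

theorem gOn_map (c : ℂ) (x : ι' → ℂ) (y : κ' → ℂ) (e : ι ↪ ι') (e' : κ ↪ κ') (s : Finset ι)
    (t : Finset κ) : gOn c x y (s.map e) (t.map e') = gOn c (x ∘ e) (y ∘ e') s t := by
  simp only [gOn, card_map, prod₂_map]

theorem dwpfOn_map [LinearOrder ι] [LinearOrder κ] [LinearOrder ι'] [LinearOrder κ'] (c : ℂ)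
    (x : ι' → ℂ) (y : κ' → ℂ) (e : ι ↪ ι') (e' : κ ↪ κ') (s : Finset ι) (t : Finset κ) :
    dwpfOn c x y (s.map e) (t.map e') = dwpfOn c (x ∘ e) (y ∘ e') s t := by
  by_cases hcard : #s = #t
  · obtain ⟨n, hn⟩ : ∃ n, #t = n := ⟨_, rfl⟩
    obtain ⟨d, rfl⟩ := exists_map_univ_eq (hcard.trans hn)
    obtain ⟨d', rfl⟩ := exists_map_univ_eq hn
    simp only [map_map, dwpfOn_map_univ]
    rfl
  · rw [dwpfOn_of_card_ne _ _ _ (by simpa using hcard), dwpfOn_of_card_ne _ _ _ hcard]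

theorem sum_powerset_map_univ {M : Type*} [AddCommMonoid M] [Fintype ι] (e : ι ↪ κ)
    (F : Finset κ → M) : ∑ α ∈ (univ.map e).powerset, F α = ∑ α : Finset ι, F (α.map e) := by
  symm
  refine sum_bij (fun α _ => α.map e) (fun α _ => ?_) (fun α _ β _ hαβ => map_injective e hαβ)
    (fun α hα => ?_) fun _ _ => rfl
  · exact mem_powerset.mpr (map_subset_map.mpr (subset_univ α))
  · obtain ⟨β, _, rfl⟩ := subset_map_iff.mp (mem_powerset.mp hα)
    exact ⟨β, mem_univ _, rfl⟩

theorem map_univ_sdiff_map [Fintype ι] [DecidableEq ι] [DecidableEq κ] (e : ι ↪ κ) (s : Finset ι) :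
    univ.map e \ s.map e = sᶜ.map e := by
  rw [compl_eq_univ_sdiff, Finset.map_sdiff]

end Transport

section Operators

variable {ι A : Type*} [LinearOrder ι] [Ring A] [Algebra ℂ A]

theorem ordProd_eq_wprod (F : ℂ → A) (x : ι → ℂ) (s : Finset ι) :
    ordProd F x s = wprod 1 (F ∘ x) s := by
  simp only [ordProd, wprod, Pi.one_apply, prod_const_one, one_smul, Function.comp_def]

theorem colT_eq_divH (c : ℂ) (T : Fin 3 → Fin 3 → ℂ → A) (j : Fin 3) (x : ι → ℂ) (s : Finset ι) :
    colT c T j x s = divH c x (T j 2 ∘ x) s := by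
  simp only [colT, divH, wprod, ordProd, prod_inv_distrib, Function.comp_def]

theorem prod_prod_eq_lt_mul_gt (φ : ι → ι → ℂ) (hφ : ∀ i, φ i i = 1) (s : Finset ι) :
    ∏ l ∈ s, ∏ m ∈ s, φ l m
      = (∏ l ∈ s, ∏ m ∈ s with m < l, φ l m) * ∏ l ∈ s, ∏ m ∈ s with m < l, φ m l := by
  simp only [prod_filter]
  rw [prod_comm (s := s) (t := s) (f := fun l m => if m < l then φ m l else 1), ← prod_mul_distrib]
  refine prod_congr rfl fun l _ => ?_
  rw [← prod_mul_distrib]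
  refine prod_congr rfl fun m _ => ?_
  rcases lt_trichotomy l m with hlm | rfl | hlm
  · simp [hlm, hlm.not_gt]
  · simp [hφ]
  · simp [hlm, hlm.not_gt]

theorem prod₂_h_smul_divH {c : ℂ} (hc : c ≠ 0) (x : ι → ℂ) (t : ι → A) {s : Finset ι}
    (hs : ∀ i ∈ s, ∀ k ∈ s, h c (x i) (x k) ≠ 0) :
    prod₂ (h c) x s x s • divH c x t s = mulH c x t s := by
  rw [prod₂, prod_prod_eq_lt_mul_gt (fun l m => h c (x l) (x m)) (fun i => h_self hc _), divH,
    mulH, wprod, wprod, smul_smul, mul_right_comm]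
  simp only [prod_inv_distrib]
  rw [mul_inv_cancel₀, one_mul]
  exact prod_ne_zero_iff.mpr fun l hl => prod_ne_zero_iff.mpr fun m hm =>
    hs l hl m (mem_filter.mp hm).1

variable {M : Type*} [AddCommMonoid M] {a b : ℕ}

theorem sum_sub_eq_sum_ite (n : ℕ) (F : Finset (Fin a) → M) :
    ∑ α : Sub a n, F α.1 = ∑ α : Finset (Fin a), if n = #α then F α else 0 := by
  rw [← sum_filter]
  exact (sum_subtype (p := fun s : Finset (Fin a) => #s = n) _ (fun s => by simp [eq_comm]) F).symm

theorem sum_range_sum_sub_eq_sum_ite (F : Finset (Fin a) → Finset (Fin b) → M) :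
    ∑ n ∈ range (min a b + 1), ∑ α : Sub a n, ∑ β : Sub b n, F α.1 β.1
      = ∑ α : Finset (Fin a), ∑ β : Finset (Fin b), if #β = #α then F α β else 0 := by
  have hpairs (n : ℕ) : ∑ α : Sub a n, ∑ β : Sub b n, F α.1 β.1 = ∑ α : Finset (Fin a),
      if n = #α then ∑ β : Finset (Fin b), if n = #β then F α β else 0 else 0 := by
    rw [← sum_sub_eq_sum_ite n fun α => ∑ β : Finset (Fin b), if n = #β then F α β else 0]
    exact sum_congr rfl fun α _ => sum_sub_eq_sum_ite n (F α)
  rw [sum_congr rfl fun n _ => hpairs n, sum_comm]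
  refine sum_congr rfl fun α _ => ?_
  simp only [sum_ite_eq', eq_comm (a := #α)]
  refine ite_eq_left_iff.mpr fun hα => (sum_eq_zero fun β _ => if_neg fun hβ => hα ?_).symm
  have hαa := card_finset_fin_le α
  have hβb := card_finset_fin_le β
  exact mem_range.mpr (by omega)

variable {c : ℂ}

theorem opX_eq_sumX (hc : c ≠ 0) (T : Fin 3 → Fin 3 → ℂ → A) (e₁ : Fin a ↪o ι) (e₂ : Fin b ↪o ι)
    {x : ι → ℂ} (huu : ∀ i j, h c (x (e₁ i)) (x (e₁ j)) ≠ 0) :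
    opX c T (x ∘ e₁) (x ∘ e₂) = sumX c x (T 0 1 ∘ x) (T 1 1 ∘ x) (T 1 2 ∘ x) (T 0 2 ∘ x)
      (univ.map e₁.toEmbedding) (univ.map e₂.toEmbedding) := by
  simp only [sumX, xSum, xTerm, xTail, sum_powerset_map_univ, map_univ_sdiff_map, prod₂_map,
    gOn_map, mulH, divH, wprod_map, sum_mul]
  rw [sum_comm]
  simp only [RelEmbedding.coe_toEmbedding, Function.comp_assoc]
  set u := x ∘ e₁
  set v := x ∘ e₂
  refine (sum_range_sum_sub_eq_sum_ite fun (α : Finset (Fin a)) (β : Finset (Fin b)) =>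
    (prod₂ (g c) v β u α * prod₂ (f c) u α u αᶜ * prod₂ (g c) v βᶜ v β * prod₂ (h c) u α u α) •
      (colT c T 0 u α * ordProd (T 0 1) u αᶜ * colT c T 1 v βᶜ * ordProd (T 1 1) v β)).trans
    (sum_congr rfl fun α _ => sum_congr rfl fun β _ => ?_)
  have hα : prod₂ (h c) u α u α • colT c T 0 u α = mulH c u (T 0 2 ∘ u) α := by
    rw [colT_eq_divH, prod₂_h_smul_divH hc u _ fun i _ k _ => huu i k]
  rw [gOn]
  split_ifs
  · change _ = (_ • (_ • (mulH c u (T 0 2 ∘ u) α * wprod 1 (T 0 1 ∘ u) αᶜ))) *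
      (_ • (divH c v (T 1 2 ∘ v) βᶜ * wprod 1 (T 1 1 ∘ v) β))
    rw [← hα, colT_eq_divH c T 1]
    simp only [ordProd_eq_wprod, smul_mul_assoc, mul_smul_comm, smul_smul, mul_assoc]
    congr 1
    ring
  · simp only [zero_smul, zero_mul]

theorem opY_eq_sumY (c : ℂ) (T : Fin 3 → Fin 3 → ℂ → A) (e₁ : Fin a ↪o ι) (e₂ : Fin b ↪o ι)
    (x : ι → ℂ) :
    opY c T (x ∘ e₁) (x ∘ e₂) = sumY c x (T 0 1 ∘ x) (T 1 1 ∘ x) (T 1 2 ∘ x) (T 0 2 ∘ x)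
      (univ.map e₁.toEmbedding) (univ.map e₂.toEmbedding) := by
  simp only [sumY, ySum, yTerm, yHead, sum_powerset_map_univ, map_univ_sdiff_map, prod₂_map,
    dwpfOn_map, divH, wprod_map, mul_sum]
  rw [sum_comm]
  simp only [RelEmbedding.coe_toEmbedding, Function.comp_assoc]
  set u := x ∘ e₁
  set v := x ∘ e₂
  have hcoeff : opY c T u v = ∑ n ∈ range (min a b + 1), ∑ α : Sub a n, ∑ β : Sub b n,
      (dwpfOn c v u β.1 α.1 * prod₂ (f c) u α.1 u α.1ᶜ * prod₂ (g c) v β.1ᶜ v β.1) •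
        (colT c T 0 v β.1 * colT c T 1 v β.1ᶜ * ordProd (T 0 1) u α.1ᶜ *
          ordProd (T 1 1) u α.1) :=
    sum_congr rfl fun n _ => sum_congr rfl fun α _ => sum_congr rfl fun β _ => by
      rw [dwpfOn_eq c v u β.2 α.2]
      rfl
  refine (hcoeff.trans (sum_range_sum_sub_eq_sum_ite
    fun (α : Finset (Fin a)) (β : Finset (Fin b)) =>
      (dwpfOn c v u β α * prod₂ (f c) u α u αᶜ * prod₂ (g c) v βᶜ v β) •
        (colT c T 0 v β * colT c T 1 v βᶜ * ordProd (T 0 1) u αᶜ * ordProd (T 1 1) u α))).trans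
    (sum_congr rfl fun α _ => sum_congr rfl fun β _ => ?_)
  split_ifs with hcard
  · change _ = (_ • (divH c v (T 0 2 ∘ v) β * divH c v (T 1 2 ∘ v) βᶜ)) *
      (_ • (_ • (wprod 1 (T 0 1 ∘ u) αᶜ * wprod 1 (T 1 1 ∘ u) α)))
    simp only [colT_eq_divH, ordProd_eq_wprod, smul_mul_assoc, mul_smul_comm, smul_smul, mul_assoc]
  · rw [dwpfOn_of_card_ne _ _ _ hcard, zero_smul, mul_zero]

theorem opX_eq_opY {D : Set ℂ} {T : Fin 3 → Fin 3 → ℂ → A} (hc : c ≠ 0) (hT : IsMonodromy c D T)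
    {u : Fin a → ℂ} {v : Fin b → ℂ} (huD : ∀ i, u i ∈ D) (hvD : ∀ j, v j ∈ D)
    (hu : Function.Injective u) (hv : Function.Injective v) (huv : ∀ i j, u i ≠ v j)
    (huu : ∀ i j, u i - u j + c ≠ 0) (hvv : ∀ i j, v i - v j + c ≠ 0)
    (hvu : ∀ i j, v j - u i + c ≠ 0) : opX c T u v = opY c T u v := by
  let x : Lex (Fin a ⊕ Fin b) → ℂ := fun i => Sum.elim u v (ofLex i)
  let e₁ : Fin a ↪o Lex (Fin a ⊕ Fin b) :=
    OrderEmbedding.ofStrictMono Sum.inlₗ Sum.Lex.inl_strictMono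
  let e₂ : Fin b ↪o Lex (Fin a ⊕ Fin b) :=
    OrderEmbedding.ofStrictMono Sum.inrₗ Sum.Lex.inr_strictMono
  have hx : Function.Injective x := (hu.sumElim hv huv).comp ofLex.injective
  have hxD : ∀ i, x i ∈ D := Sum.forall.mpr ⟨huD, hvD⟩
  have hUV : Disjoint (univ.map e₁.toEmbedding) (univ.map e₂.toEmbedding) := by
    simp only [disjoint_left, mem_map, mem_univ, true_and, not_exists, forall_exists_index,
      forall_apply_eq_imp_iff]
    exact fun i j hij => huv i j (congrArg x hij).symm
  have hh : ∀ j ∈ univ.map e₂.toEmbedding, ∀ k ∈ univ.map e₁.toEmbedding ∪ univ.map e₂.toEmbedding,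
      h c (x j) (x k) ≠ 0 := by
    simp only [mem_map, mem_union, mem_univ, true_and, forall_exists_index, forall_apply_eq_imp_iff,
      or_imp, forall_and]
    exact ⟨fun j i => h_ne_zero hc (hvu i j), fun j k => h_ne_zero hc (hvv j k)⟩
  calc opX c T u v = _ := opX_eq_sumX hc T e₁ e₂ (x := x) fun i j => h_ne_zero hc (huu i j)
    _ = _ := sumX_eq_sumY (hT.isExchangeFamily hc hx hxD) hc hx hUV hh
    _ = opY c T u v := (opY_eq_sumY c T e₁ e₂ x).symm

end Operators

section Twist

variable {A : Type*} [Ring A] [Algebra ℂ A]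

/-- The factor of `T_{ji}` in the entry `ij` of the twisted monodromy matrix: the sign which `ψ`
attaches to `T_{ij}`, times `-i` for odd `T_{ij}`. -/
def twistCoeff (i j : Fin 3) : ℂ :=
  (-1) ^ (par i * par j + par i) * (-Complex.I) ^ ((par i + par j) % 2)

/-- The image of the monodromy matrix under `ψ`, with values in the opposite algebra. Rescaling the
odd entries by `-i` absorbs the sign in `ψ(AB) = (-1)^([A][B]) ψ(B) ψ(A)`, so that `ψ` becomes an
algebra morphism. -/
def twist (T : Fin 3 → Fin 3 → ℂ → A) (i j : Fin 3) (u : ℂ) : Aᵐᵒᵖ :=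
  MulOpposite.op (twistCoeff i j • T j i u)

theorem twistCoeff_mul_twistCoeff (i j k l : Fin 3) :
    twistCoeff i j * twistCoeff k l * ((-1) ^ ((par j + par i) * (par l + par k)) *
        (-1) ^ (par j * (par l + par k) + par l * par k))
      = (-1) ^ (par i * (par k + par l) + par k * par l) * (twistCoeff k j * twistCoeff i l) := by
  fin_cases i <;> fin_cases j <;> fin_cases k <;> fin_cases l <;> norm_num [twistCoeff, par]

theorem IsMonodromy.twist {c : ℂ} {D : Set ℂ} {T : Fin 3 → Fin 3 → ℂ → A}
    (hT : IsMonodromy c D T) : IsMonodromy c D (twist T) := by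
  intro i j k l u hu v hv huv
  have hrel := hT j i l k u hu v hv huv
  have hcoeff := twistCoeff_mul_twistCoeff i j k l
  apply MulOpposite.unop_injective
  simp only [SuperYangian.twist, MulOpposite.unop_sub, MulOpposite.unop_smul, MulOpposite.unop_mul,
    MulOpposite.unop_op, smul_mul_smul_comm]
  rw [add_comm (par i), add_comm (par k)]
  set s : ℂ := (-1) ^ ((par j + par i) * (par l + par k)) with hs
  have hss : s * s = 1 := by rw [hs, ← mul_pow, neg_one_mul, neg_neg, one_pow]
  linear_combination (norm := module)
    (-(twistCoeff i j * twistCoeff k l * s)) • hrel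
      - hss • ((twistCoeff i j * twistCoeff k l) • (T l k v * T j i u))
      + (g c u v) • (hcoeff • (T l i u * T j k v - T l i v * T j k u))

end Twist

section Words

theorem basisFreeMonoid_eq (w : FreeMonoid Gen) :
    FreeAlgebra.basisFreeMonoid ℂ Gen w = (w.toList.map (FreeAlgebra.ι ℂ)).prod := by
  simp [FreeAlgebra.basisFreeMonoid, FreeAlgebra.equivMonoidAlgebraFreeMonoid,
    FreeMonoid.lift_apply]

theorem psi_word (w : List Gen) : psi (w.map (FreeAlgebra.ι ℂ)).prod = psiWord w := by
  have hbasis := basisFreeMonoid_eq (FreeMonoid.ofList w)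
  rw [FreeMonoid.toList_ofList] at hbasis
  rw [← hbasis, psi, Module.Basis.constr_basis, FreeMonoid.toList_ofList]

/-- The span of the monomials of parity `p`; the parities `[i] + [j]` of the letters are added up in
`ℕ`, not modulo `2`. -/
def wordSpan (p : ℕ) : Submodule ℂ (FreeAlgebra ℂ Gen) :=
  Submodule.span ℂ {y | ∃ w : List Gen, wordPar w = p ∧ (w.map (FreeAlgebra.ι ℂ)).prod = y}

theorem mul_mem_wordSpan {p q : ℕ} {y z : FreeAlgebra ℂ Gen} (hy : y ∈ wordSpan p)
    (hz : z ∈ wordSpan q) : y * z ∈ wordSpan (p + q) := by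
  have hyz := Submodule.mul_mem_mul hy hz
  rw [wordSpan, wordSpan, Submodule.span_mul_span] at hyz
  refine Submodule.span_mono ?_ hyz
  rintro _ ⟨_, ⟨w, rfl, rfl⟩, _, ⟨w', rfl, rfl⟩, rfl⟩
  exact ⟨w ++ w', by simp [wordPar], by simp⟩

theorem one_mem_wordSpan : (1 : FreeAlgebra ℂ Gen) ∈ wordSpan 0 :=
  Submodule.subset_span ⟨[], rfl, rfl⟩

theorem genT_mem_wordSpan (i j : Fin 3) (u : ℂ) : genT i j u ∈ wordSpan (par i + par j) :=
  Submodule.subset_span ⟨[(i, j, u)], by simp [wordPar], by simp [genT]⟩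

theorem ordProd_genT_mem_wordSpan {ι : Type*} [LinearOrder ι] (i j : Fin 3) (x : ι → ℂ)
    (s : Finset ι) : ordProd (genT i j) x s ∈ wordSpan (#s * (par i + par j)) := by
  rw [ordProd, ← length_sort (s := s) (· ≤ ·)]
  induction s.sort with
  | nil => simpa using one_mem_wordSpan
  | cons k l ih =>
    rw [List.map_cons, List.prod_cons, List.length_cons, add_mul, one_mul, add_comm]
    exact mul_mem_wordSpan (genT_mem_wordSpan i j _) ih

theorem colT_genT_mem_wordSpan {ι : Type*} [LinearOrder ι] (c : ℂ) (j : Fin 3) (x : ι → ℂ)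
    (s : Finset ι) : colT c genT j x s ∈ wordSpan (#s * (par j + 1)) :=
  Submodule.smul_mem _ _ (ordProd_genT_mem_wordSpan j 2 x s)

theorem opX_genT_mem_wordSpan (c : ℂ) {a b : ℕ} (u : Fin a → ℂ) (v : Fin b → ℂ) :
    opX c genT u v ∈ wordSpan b := by
  refine sum_mem fun n _ => sum_mem fun α _ => sum_mem fun β _ => Submodule.smul_mem _ _ ?_
  have hterm := mul_mem_wordSpan (mul_mem_wordSpan (mul_mem_wordSpan
    (colT_genT_mem_wordSpan c 0 u α.1) (ordProd_genT_mem_wordSpan 0 1 u α.1ᶜ))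
    (colT_genT_mem_wordSpan c 1 v β.1ᶜ)) (ordProd_genT_mem_wordSpan 1 1 v β.1)
  convert hterm using 2
  have hβ := card_add_card_compl β.1
  rw [Fintype.card_fin, β.2] at hβ
  simpa [par, α.2] using hβ.symm

theorem neg_one_pow_mul_I_pow_mod_two (p q : ℕ) :
    (-1 : ℂ) ^ (p * q) * Complex.I ^ (q % 2)
      = Complex.I ^ ((p + q) % 2) * (-Complex.I) ^ (p % 2) := by
  rcases Nat.mod_two_eq_zero_or_one p with hp | hp <;>
    rcases Nat.mod_two_eq_zero_or_one q with hq | hq <;>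
      rw [neg_one_pow_eq_pow_mod_two, Nat.mul_mod, Nat.add_mod, hp, hq] <;> simp

variable {H : Type*} [AddCommGroup H] [Module ℂ H]

theorem evalT_psiWord (T : Fin 3 → Fin 3 → ℂ → Module.End ℂ H) (w : List Gen) :
    evalT T (psiWord w) = Complex.I ^ (wordPar w % 2) • MulOpposite.unop
      (FreeAlgebra.lift ℂ (fun x : Gen => twist T x.1 x.2.1 x.2.2)
        (w.map (FreeAlgebra.ι ℂ)).prod) := by
  induction w with
  | nil => simp [psiWord, wordPar]
  | cons y w ih =>
    obtain ⟨i, j, u⟩ := y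
    have hw : wordPar ((i, j, u) :: w) = (par i + par j) + wordPar w := by simp [wordPar]
    rw [psiWord, map_smul, map_mul, ih, map_smul, List.map_cons, List.prod_cons, map_mul, hw,
      MulOpposite.unop_mul, FreeAlgebra.lift_ι_apply]
    simp only [genT, evalT, FreeAlgebra.lift_ι_apply, twist, MulOpposite.unop_op,
      smul_mul_assoc, mul_smul_comm, smul_smul]
    congr 1
    rw [twistCoeff]
    linear_combination (-1) ^ (par i * par j + par i) *
      neg_one_pow_mul_I_pow_mod_two (par i + par j) (wordPar w)

theorem evalT_psi_of_mem_wordSpan (T : Fin 3 → Fin 3 → ℂ → Module.End ℂ H) {p : ℕ}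
    {y : FreeAlgebra ℂ Gen} (hy : y ∈ wordSpan p) :
    evalT T (psi y) = Complex.I ^ (p % 2) • MulOpposite.unop
      (FreeAlgebra.lift ℂ (fun x : Gen => twist T x.1 x.2.1 x.2.2) y) := by
  induction hy using Submodule.span_induction with
  | mem y hy =>
    obtain ⟨w, rfl, rfl⟩ := hy
    rw [psi_word, evalT_psiWord]
  | zero => simp
  | add y z _ _ hy hz => simp only [map_add, hy, hz, MulOpposite.unop_add, smul_add]
  | smul r y _ hy => rw [map_smul, map_smul, hy, map_smul, MulOpposite.unop_smul, smul_comm]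

theorem map_opX {A B : Type*} [Ring A] [Algebra ℂ A] [Ring B] [Algebra ℂ B] (φ : A →ₐ[ℂ] B)
    (c : ℂ) (T : Fin 3 → Fin 3 → ℂ → A) {a b : ℕ} (u : Fin a → ℂ) (v : Fin b → ℂ) :
    φ (opX c T u v) = opX c (fun i j z => φ (T i j z)) u v := by
  simp only [opX, partX, colT, ordProd, map_sum, map_smul, map_mul, map_list_prod, List.map_map,
    Function.comp_def]

theorem evalT_psi_opX (T : Fin 3 → Fin 3 → ℂ → Module.End ℂ H) (c : ℂ) {a b : ℕ} (u : Fin a → ℂ)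
    (v : Fin b → ℂ) :
    evalT T (psi (opX c genT u v))
      = Complex.I ^ (b % 2) • MulOpposite.unop (opX c (twist T) u v) := by
  rw [evalT_psi_of_mem_wordSpan T (opX_genT_mem_wordSpan c u v), map_opX]
  simp only [genT, FreeAlgebra.lift_ι_apply]

theorem dualBethe_eq (c : ℂ) (T : Fin 3 → Fin 3 → ℂ → Module.End ℂ H) (Ω' : Module.Dual ℂ H)
    {a b : ℕ} (u : Fin a → ℂ) (v : Fin b → ℂ) :
    dualBethe c T Ω' u v
      = Complex.I ^ (b % 2) • (Ω' ∘ₗ MulOpposite.unop (opX c (twist T) u v)) := by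
  rw [dualBethe, evalT_psi_opX, LinearMap.comp_smul]

theorem I_pow_mod_two_mul_neg_I_pow (b : ℕ) :
    Complex.I ^ (b % 2) * (-Complex.I) ^ b = (-1) ^ (b * (b - 1) / 2) := by
  rw [← Nat.choose_two_right]
  induction b using Nat.twoStepInduction with
  | zero => simp
  | one => simp
  | more b ih _ =>
    have hchoose : (b + 2).choose 2 = b.choose 2 + (2 * b + 1) := by
      simp only [Nat.choose_succ_succ' _ 1, Nat.choose_one_right]
      ring
    rw [hchoose, Nat.add_mod_right, pow_add, ← mul_assoc, ih, pow_add, neg_sq, Complex.I_sq,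
      (odd_two_mul_add_one b).neg_one_pow]

end Words

section OppositeProducts

variable {ι A : Type*} [LinearOrder ι] [Ring A] [Algebra ℂ A]

theorem rowT_eq_wprod (c : ℂ) (T : Fin 3 → Fin 3 → ℂ → A) (k : Fin 3) (x : ι → ℂ) (s : Finset ι) :
    rowT c T k x s = wprod (fun i j => (h c (x i) (x j))⁻¹) (T 2 k ∘ x) s := by
  simp only [rowT, wprod, ordProd, prod_inv_distrib, Function.comp_def]

variable {c : ℂ} {D : Set ℂ} {T : Fin 3 → Fin 3 → ℂ → A}

theorem unop_ordProd_twist (hT : IsMonodromy c D T) {i j : Fin 3} (hi : par i = 0)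
    (hj : par j = 0) {x : ι → ℂ} (hxD : ∀ k, x k ∈ D) (s : Finset ι) :
    (ordProd (twist T i j) x s).unop = ordProd (T j i) x s := by
  have hentry : (fun k => ((twist T i j ∘ x) k).unop) = T j i ∘ x := by
    ext1 k
    simp [twist, twistCoeff, hi, hj]
  have hcomm : WeightCommute 1 (twist T i j ∘ x) s := fun k _ l _ _ => by
    simp [hT.twist.commute_even hi hj (hxD k) (hxD l)]
  rw [ordProd_eq_wprod, unop_wprod hcomm, hentry, ordProd_eq_wprod]
  rfl

theorem unop_colT_twist (hT : IsMonodromy c D T) (hc : c ≠ 0) {j : Fin 3} (hj : par j = 0)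
    {x : ι → ℂ} (hx : Function.Injective x) (hxD : ∀ k, x k ∈ D) {s : Finset ι}
    (hs : ∀ k ∈ s, ∀ l ∈ s, h c (x k) (x l) ≠ 0) :
    (colT c (twist T) j x s).unop = (-Complex.I) ^ #s • rowT c T j x s := by
  have hentry : (fun k => ((twist T j 2 ∘ x) k).unop) = fun k => -Complex.I • (T 2 j ∘ x) k := by
    ext1 k
    simp [twist, twistCoeff, hj, show par 2 = 1 from rfl]
  rw [colT_eq_divH, divH,
    unop_wprod ((hT.twist.oddExchanges hc hj hx hxD).selfExchanges_div hc hx hs).weightCommute,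
    hentry, wprod_smul, rowT_eq_wprod]

variable {a b : ℕ} {u : Fin a → ℂ} {v : Fin b → ℂ}

theorem pow_card_mul_pow_card_compl {M : Type*} [Monoid M] (z : M) (s : Finset (Fin b)) :
    z ^ #s * z ^ #sᶜ = z ^ b := by
  rw [← pow_add, card_add_card_compl, Fintype.card_fin]

theorem unop_opX_twist (hT : IsMonodromy c D T) (hc : c ≠ 0) (hu : Function.Injective u)
    (hv : Function.Injective v) (huD : ∀ i, u i ∈ D) (hvD : ∀ j, v j ∈ D)
    (huu : ∀ i j, h c (u i) (u j) ≠ 0) (hvv : ∀ i j, h c (v i) (v j) ≠ 0) :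
    (opX c (twist T) u v).unop = (-Complex.I) ^ b • ∑ n ∈ range (min a b + 1),
      ∑ α : Sub a n, ∑ β : Sub b n, coeffX c u v α β • (ordProd (T 1 1) v β.1 *
        (rowT c T 1 v β.1ᶜ * ordProd (T 1 0) u α.1ᶜ * rowT c T 0 u α.1)) := by
  simp only [opX, partX, Finset.unop_sum, smul_sum, MulOpposite.unop_smul, MulOpposite.unop_mul,
    unop_ordProd_twist hT (i := 1) (j := 1) rfl rfl hvD,
    unop_ordProd_twist hT (i := 0) (j := 1) rfl rfl huD]
  refine sum_congr rfl fun n _ => sum_congr rfl fun α _ => sum_congr rfl fun β _ => ?_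
  rw [unop_colT_twist hT hc rfl hu huD fun k _ l _ => huu k l,
    unop_colT_twist hT hc rfl hv hvD fun k _ l _ => hvv k l, α.2.trans β.2.symm,
    ← pow_card_mul_pow_card_compl (-Complex.I) β.1]
  simp only [smul_mul_assoc, mul_smul_comm, smul_smul, mul_assoc]
  congr 1
  ring

theorem unop_opY_twist (hT : IsMonodromy c D T) (hc : c ≠ 0) (hv : Function.Injective v)
    (huD : ∀ i, u i ∈ D) (hvD : ∀ j, v j ∈ D) (hvv : ∀ i j, h c (v i) (v j) ≠ 0) :
    (opY c (twist T) u v).unop = (-Complex.I) ^ b • ∑ n ∈ range (min a b + 1),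
      ∑ α : Sub a n, ∑ β : Sub b n, coeffY c u v α β • (ordProd (T 1 1) u α.1 *
        (ordProd (T 1 0) u α.1ᶜ * rowT c T 1 v β.1ᶜ * rowT c T 0 v β.1)) := by
  simp only [opY, partY, Finset.unop_sum, smul_sum, MulOpposite.unop_smul, MulOpposite.unop_mul,
    unop_ordProd_twist hT (i := 1) (j := 1) rfl rfl huD,
    unop_ordProd_twist hT (i := 0) (j := 1) rfl rfl huD]
  refine sum_congr rfl fun n _ => sum_congr rfl fun α _ => sum_congr rfl fun β _ => ?_
  rw [unop_colT_twist hT hc rfl hv hvD fun k _ l _ => hvv k l,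
    unop_colT_twist hT hc rfl hv hvD fun k _ l _ => hvv k l,
    ← pow_card_mul_pow_card_compl (-Complex.I) β.1]
  simp only [smul_mul_assoc, mul_smul_comm, smul_smul, mul_assoc]
  congr 1
  ring

end OppositeProducts

section Vacuum

variable {H : Type*} [AddCommGroup H] [Module ℂ H] {D : Set ℂ}
  {T : Fin 3 → Fin 3 → ℂ → Module.End ℂ H} {lam : Fin 3 → ℂ → ℂ}

section Products

variable {ι : Type*} [LinearOrder ι] {x : ι → ℂ}

theorem IsVacuum.mul_ordProd_apply {Ω : H} (hΩ : IsVacuum D T lam Ω) (i : Fin 3)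
    (hx : ∀ k, x k ∈ D) (B : Module.End ℂ H) (s : Finset ι) :
    (B * ordProd (T i i) x s) Ω = (∏ k ∈ s, lam i (x k)) • B Ω := by
  rw [ordProd_eq_wprod, Module.End.mul_apply, ← map_smul]
  congr 1
  induction s using Finset.induction_on_min with
  | empty => simp
  | insert m s hm ih =>
    rw [wprod_insert_of_forall_lt _ _ hm, prod_insert fun h => lt_irrefl _ (hm m h)]
    simp only [Pi.one_apply, prod_const_one, one_smul, Module.End.mul_apply, ih, map_smul,
      Function.comp_apply, hΩ.1 i _ (hx m), smul_smul]
    rw [mul_comm]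

theorem IsDualVacuum.comp_ordProd_mul {Ω' : Module.Dual ℂ H} (hΩ : IsDualVacuum D T lam Ω')
    (i : Fin 3) (hx : ∀ k, x k ∈ D) (B : Module.End ℂ H) (s : Finset ι) :
    Ω' ∘ₗ (ordProd (T i i) x s * B) = (∏ k ∈ s, lam i (x k)) • (Ω' ∘ₗ B) := by
  rw [ordProd_eq_wprod, Module.End.mul_eq_comp, ← LinearMap.comp_assoc, ← LinearMap.smul_comp]
  congr 1
  induction s using Finset.induction_on_min with
  | empty =>
    ext
    simp
  | insert m s hm ih =>
    rw [wprod_insert_of_forall_lt _ _ hm, prod_insert fun h => lt_irrefl _ (hm m h)]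
    simp only [Pi.one_apply, prod_const_one, one_smul, Module.End.mul_eq_comp,
      ← LinearMap.comp_assoc, Function.comp_apply, hΩ.1 i _ (hx m), LinearMap.smul_comp, ih,
      smul_smul]

end Products

variable {c : ℂ} {a b : ℕ} {u : Fin a → ℂ} {v : Fin b → ℂ}

theorem IsVacuum.opX_apply {Ω : H} (hΩ : IsVacuum D T lam Ω) (c : ℂ) (u : Fin a → ℂ)
    (hvD : ∀ j, v j ∈ D) :
    opX c T u v Ω = ∑ n ∈ range (min a b + 1), ∑ α : Sub a n, ∑ β : Sub b n,
      (coeffX c u v α β * ∏ j ∈ β.1, lam 1 (v j)) •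
        (colT c T 0 u α.1 * ordProd (T 0 1) u α.1ᶜ * colT c T 1 v β.1ᶜ) Ω := by
  simp only [opX, partX, LinearMap.sum_apply, LinearMap.smul_apply, hΩ.mul_ordProd_apply 1 hvD,
    smul_smul]

theorem IsVacuum.opY_apply {Ω : H} (hΩ : IsVacuum D T lam Ω) (c : ℂ) (huD : ∀ i, u i ∈ D)
    (v : Fin b → ℂ) :
    opY c T u v Ω = ∑ n ∈ range (min a b + 1), ∑ α : Sub a n, ∑ β : Sub b n,
      (coeffY c u v α β * ∏ i ∈ α.1, lam 1 (u i)) •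
        (colT c T 0 v β.1 * colT c T 1 v β.1ᶜ * ordProd (T 0 1) u α.1ᶜ) Ω := by
  simp only [opY, partY, LinearMap.sum_apply, LinearMap.smul_apply, hΩ.mul_ordProd_apply 1 huD,
    smul_smul]

theorem comp_sum {R M N P κ : Type*} [CommSemiring R] [AddCommMonoid M] [Module R M]
    [AddCommMonoid N] [Module R N] [AddCommMonoid P] [Module R P] (φ : N →ₗ[R] P) (s : Finset κ)
    (F : κ → M →ₗ[R] N) : φ ∘ₗ ∑ k ∈ s, F k = ∑ k ∈ s, φ ∘ₗ F k :=
  map_sum (LinearMap.llcomp R M N P φ) F s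

theorem IsDualVacuum.comp_unop_opX_twist {Ω' : Module.Dual ℂ H} (hΩ : IsDualVacuum D T lam Ω')
    (hT : IsMonodromy c D T) (hc : c ≠ 0) (hu : Function.Injective u)
    (hv : Function.Injective v) (huD : ∀ i, u i ∈ D) (hvD : ∀ j, v j ∈ D)
    (huu : ∀ i j, h c (u i) (u j) ≠ 0) (hvv : ∀ i j, h c (v i) (v j) ≠ 0) :
    Ω' ∘ₗ (opX c (twist T) u v).unop = (-Complex.I) ^ b • ∑ n ∈ range (min a b + 1),
      ∑ α : Sub a n, ∑ β : Sub b n, (coeffX c u v α β * ∏ j ∈ β.1, lam 1 (v j)) •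
        (Ω' ∘ₗ (rowT c T 1 v β.1ᶜ * ordProd (T 1 0) u α.1ᶜ * rowT c T 0 u α.1)) := by
  simp only [unop_opX_twist hT hc hu hv huD hvD huu hvv, LinearMap.comp_smul, comp_sum,
    hΩ.comp_ordProd_mul 1 hvD, smul_smul]

theorem IsDualVacuum.comp_unop_opY_twist {Ω' : Module.Dual ℂ H} (hΩ : IsDualVacuum D T lam Ω')
    (hT : IsMonodromy c D T) (hc : c ≠ 0) (hv : Function.Injective v)
    (huD : ∀ i, u i ∈ D) (hvD : ∀ j, v j ∈ D) (hvv : ∀ i j, h c (v i) (v j) ≠ 0) :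
    Ω' ∘ₗ (opY c (twist T) u v).unop = (-Complex.I) ^ b • ∑ n ∈ range (min a b + 1),
      ∑ α : Sub a n, ∑ β : Sub b n, (coeffY c u v α β * ∏ i ∈ α.1, lam 1 (u i)) •
        (Ω' ∘ₗ (ordProd (T 1 0) u α.1ᶜ * rowT c T 1 v β.1ᶜ * rowT c T 0 v β.1)) := by
  simp only [unop_opY_twist hT hc hv huD hvD hvv, LinearMap.comp_smul, comp_sum,
    hΩ.comp_ordProd_mul 1 huD, smul_smul]

end Vacuum

section LowestTerms

variable {A : Type*} [Ring A] [Algebra ℂ A] {a b : ℕ}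

theorem sum_sub_zero {M : Type*} [AddCommMonoid M] (F : Sub a 0 → M) :
    ∑ α, F α = F ⟨∅, card_empty⟩ :=
  Fintype.sum_eq_single _ fun α hα => (hα (Subtype.ext (card_eq_zero.mp α.2))).elim

theorem partX_zero (c : ℂ) (T : Fin 3 → Fin 3 → ℂ → A) (u : Fin a → ℂ) (v : Fin b → ℂ) :
    partX c T u v 0 = ordProd (T 0 1) u univ * colT c T 1 v univ := by
  rw [partX, sum_sub_zero, sum_sub_zero]
  simp [coeffX, prod₂, colT, ordProd]

theorem partY_zero (c : ℂ) (T : Fin 3 → Fin 3 → ℂ → A) (u : Fin a → ℂ) (v : Fin b → ℂ) :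
    partY c T u v 0 = colT c T 1 v univ * ordProd (T 0 1) u univ := by
  rw [partY, sum_sub_zero, sum_sub_zero]
  simp [coeffY, dwpf, prod₂, colT, ordProd]

theorem sum_range_succ_eq_zero_add_sum_Icc {M : Type*} [AddCommMonoid M] (F : ℕ → M) (m : ℕ) :
    ∑ n ∈ range (m + 1), F n = F 0 + ∑ n ∈ Icc 1 m, F n := by
  rw [range_eq_Ico, sum_eq_sum_Ico_succ_bot (Nat.succ_pos m)]
  rfl

theorem opX_eq_mul_add_sum (c : ℂ) (T : Fin 3 → Fin 3 → ℂ → A) (u : Fin a → ℂ) (v : Fin b → ℂ) :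
    opX c T u v = ordProd (T 0 1) u univ * colT c T 1 v univ
      + ∑ n ∈ Icc 1 (min a b), partX c T u v n := by
  rw [opX, sum_range_succ_eq_zero_add_sum_Icc, partX_zero]

theorem opY_eq_mul_add_sum (c : ℂ) (T : Fin 3 → Fin 3 → ℂ → A) (u : Fin a → ℂ) (v : Fin b → ℂ) :
    opY c T u v = colT c T 1 v univ * ordProd (T 0 1) u univ
      + ∑ n ∈ Icc 1 (min a b), partY c T u v n := by
  rw [opY, sum_range_succ_eq_zero_add_sum_Icc, partY_zero]

end LowestTerms

end

end SuperYangian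

open SuperYangian in
theorem mainTheorem2 {H : Type*} [AddCommGroup H] [Module ℂ H]
    (c : ℂ) (hc : c ≠ 0) (D : Set ℂ) (T : Fin 3 → Fin 3 → ℂ → Module.End ℂ H)
    (hT : IsMonodromy c D T)
    (a b : ℕ) (u : Fin a → ℂ) (v : Fin b → ℂ)
    (huD : ∀ i, u i ∈ D) (hvD : ∀ j, v j ∈ D)
    (hu : Function.Injective u) (hv : Function.Injective v) (huv : ∀ i j, u i ≠ v j)
    (huu : ∀ i j, u i - u j + c ≠ 0) (hvv : ∀ i j, v i - v j + c ≠ 0)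
    (hvu : ∀ i j, v j - u i + c ≠ 0) :
    opX c T u v = opY c T u v ∧
    (ordProd (T 0 1) u Finset.univ * colT c T 1 v Finset.univ
        - colT c T 1 v Finset.univ * ordProd (T 0 1) u Finset.univ
      = ∑ n ∈ Finset.Icc 1 (min a b), (partY c T u v n - partX c T u v n)) ∧
    (∀ (lam : Fin 3 → ℂ → ℂ) (Ω : H), IsVacuum D T lam Ω →
      bethe c T Ω u v = opY c T u v Ω ∧
      bethe c T Ω u v = ∑ n ∈ Finset.range (min a b + 1), ∑ α : Sub a n, ∑ β : Sub b n,
        (coeffX c u v α β * ∏ j ∈ β.1, lam 1 (v j)) •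
          (colT c T 0 u α.1 * ordProd (T 0 1) u α.1ᶜ * colT c T 1 v β.1ᶜ) Ω ∧
      bethe c T Ω u v = ∑ n ∈ Finset.range (min a b + 1), ∑ α : Sub a n, ∑ β : Sub b n,
        (coeffY c u v α β * ∏ i ∈ α.1, lam 1 (u i)) •
          (colT c T 0 v β.1 * colT c T 1 v β.1ᶜ * ordProd (T 0 1) u α.1ᶜ) Ω) ∧
    (∀ (lam : Fin 3 → ℂ → ℂ) (Ω' : Module.Dual ℂ H), IsDualVacuum D T lam Ω' →
      dualBethe c T Ω' u v = (-1 : ℂ) ^ (b * (b - 1) / 2) •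
        ∑ n ∈ Finset.range (min a b + 1), ∑ α : Sub a n, ∑ β : Sub b n,
          (coeffX c u v α β * ∏ j ∈ β.1, lam 1 (v j)) •
            (Ω' ∘ₗ (rowT c T 1 v β.1ᶜ * ordProd (T 1 0) u α.1ᶜ * rowT c T 0 u α.1)) ∧
      dualBethe c T Ω' u v = (-1 : ℂ) ^ (b * (b - 1) / 2) •
        ∑ n ∈ Finset.range (min a b + 1), ∑ α : Sub a n, ∑ β : Sub b n,
          (coeffY c u v α β * ∏ i ∈ α.1, lam 1 (u i)) •
            (Ω' ∘ₗ (ordProd (T 1 0) u α.1ᶜ * rowT c T 1 v β.1ᶜ * rowT c T 0 v β.1))) := by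
  have hXY := opX_eq_opY hc hT huD hvD hu hv huv huu hvv hvu
  have huu' : ∀ i j, h c (u i) (u j) ≠ 0 := fun i j => h_ne_zero hc (huu i j)
  have hvv' : ∀ i j, h c (v i) (v j) ≠ 0 := fun i j => h_ne_zero hc (hvv i j)
  refine ⟨hXY, ?commutator, fun lam Ω hΩ => ⟨?_, ?_, ?_⟩, fun lam Ω' hΩ' => ⟨?_, ?_⟩⟩
  case commutator =>
    rw [opX_eq_mul_add_sum, opY_eq_mul_add_sum] at hXY
    rw [sum_sub_distrib, sub_eq_sub_iff_add_eq_add, hXY, add_comm]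
  · rw [bethe, hXY]
  · rw [bethe, hΩ.opX_apply c u hvD]
  · rw [bethe, hXY, hΩ.opY_apply c huD v]
  · rw [dualBethe_eq, hΩ'.comp_unop_opX_twist hT hc hu hv huD hvD huu' hvv', smul_smul,
      I_pow_mod_two_mul_neg_I_pow]
  · rw [dualBethe_eq, opX_eq_opY hc hT.twist huD hvD hu hv huv huu hvv hvu,
      hΩ'.comp_unop_opY_twist hT hc hv huD hvD hvv', smul_smul, I_pow_mod_two_mul_neg_I_pow]
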